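/- A \emph{vincular pattern} of length $k$ is a pair $(\sigma,T)$ with $\sigma\in S_k$ and $T\subseteq\{1,\dots,k-1\}$. A permutation $\pi\in S_n$ \emph{contains} $(\sigma,T)$ if there are indices $1\le i_1<\dots<i_k\le n$ such that $\pi_{i_1}\cdots\pi_{i_k}$ is order-isomorphic to $\sigma_1\cdots\sigma_k$ and $i_{j+1}=i_j+1$ for all $j\in T$; otherwise $\pi$ \emph{avoids} it. Two vincular patterns are \emph{Wilf-equivalent} if, for every positive integer $n$, they are avoided by the same number of permutations in $S_n$. A \emph{quasi-consecutive} pattern of length $5$ is one with $T=\{1,2,3\}$; it is written $abcd\text{-}e$, where $abcde=\sigma_1\sigma_2\sigma_3\sigma_4\sigma_5$. Its \emph{complement} is the quasi-consecutive pattern obtained by replacing each letter $v$ by $6-v$. **Theorem.** The $120$ quasi-consecutive patterns of length $5$ fall into exactly $26$ Wilf-equivalence classes. They are the $26$ sets A, …, Z each of which consists of the patterns in the corresponding row below together with their complements: - A: 1254-3, 1354-2 - B: 1453-2, 1543-2 - C: 2135-4, 2145-3 - D: 1534-2 - E: 2315-4 - F: 1243-5, 1253-4, 2134-5, 2354-1,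 3145-2, 3245-1 - G: 3125-4, 3215-4 - H: 1523-4 - I: 3251-4 - J: 2154-3 - K: 1435-2 - L: 3124-5, 3214-5, 2543-1, 2453-1, 2341-5, 2431-5, 1342-5, 1432-5, 1352-4, 1452-3, 1532-4, 1542-3, 2531-4, 2541-3, 2351-4, 2451-3 - M: 2153-4, 3154-2 - N: 2513-4 - O: 1524-3 - P: 2415-3 - Q: 1325-4 - R: 1423-5, 2314-5, 2534-1, 3241-5 - S: 2143-5, 3254-1 - T: 3152-4 - U: 1425-3 - V: 1324-5, 2435-1 - W: 2514-3 - X: 2413-5, 3142-5 - Y: 1235-4, 1245-3, 1345-2 - Z: 1234-5, 2345-1 -/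

import Mathlib

/-- Two sequences are order-isomorphic if their entries compare in the same way. -/
def OrderIsomorphic {k : ℕ} {α β : Type*} [LT α] [LT β] (a : Fin k → α) (b : Fin k → β) : Prop :=
  ∀ i j : Fin k, a i < a j ↔ b i < b j

/-- A vincular pattern of length `k`: a permutation together with a set of adjacencies.
Positions and values are counted from `0`; `j ∈ adj` (with `0 ≤ j < k - 1`) says that the
entries at positions `j` and `j + 1` have to be adjacent, i.e. that there is no dash between
them. -/
structure VincularPattern (k : ℕ) where
  perm : Equiv.Perm (Fin k)
  adj : Set (Fin (k - 1))

namespace VincularPattern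

variable {k : ℕ}

/-- The permutation `π` of `n` letters contains the vincular pattern `p`. -/
def ContainedIn {n : ℕ} (p : VincularPattern k) (π : Equiv.Perm (Fin n)) : Prop :=
  ∃ i : Fin k → Fin n, StrictMono i ∧
    OrderIsomorphic (fun a => π (i a)) (fun a => p.perm a) ∧
    ∀ j ∈ p.adj,
      (i ⟨(j : ℕ) + 1, by omega⟩ : ℕ) = (i ⟨(j : ℕ), by omega⟩ : ℕ) + 1

/-- The set of permutations of `n` letters that avoid the vincular pattern `p`. -/
def avoiders (p : VincularPattern k) (n : ℕ) : Set (Equiv.Perm (Fin n)) :=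
  {π | ¬ p.ContainedIn π}

/-- Wilf-equivalence of vincular patterns. -/
def WilfEquiv {l : ℕ} (p : VincularPattern k) (q : VincularPattern l) : Prop :=
  ∀ n : ℕ, 0 < n → (p.avoiders n).ncard = (q.avoiders n).ncard

/-- A pattern is quasi-consecutive if it has exactly one dash, before its last letter. -/
def IsQuasiConsecutive (p : VincularPattern k) : Prop :=
  ∀ j : Fin (k - 1), j ∈ p.adj ↔ (j : ℕ) + 2 < k

/-- The complement of a pattern: every value `v` of `1, …, k` is replaced by `k + 1 - v`, and the
adjacencies are kept. -/
def complement (p : VincularPattern k) : VincularPattern k where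
  perm := p.perm.trans Fin.revPerm
  adj := p.adj

/-- The word `σ₁ σ₂ ⋯ σ_k` of a pattern, with letters `1, …, k`. -/
def word (p : VincularPattern k) : List ℕ :=
  List.ofFn fun i => (p.perm i : ℕ) + 1

end VincularPattern

/-- Quasi-consecutive vincular patterns of length `k`. -/
abbrev QuasiConsecutivePattern (k : ℕ) : Type :=
  {p : VincularPattern k // p.IsQuasiConsecutive}

/-- Wilf-equivalence as an equivalence relation on quasi-consecutive patterns of length `k`. -/
def wilfSetoid (k : ℕ) : Setoid (QuasiConsecutivePattern k) where
  r p q := p.1.WilfEquiv q.1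
  iseqv :=
    { refl := fun _ _ _ => rfl
      symm := fun h n hn => (h n hn).symm
      trans := fun h h' n hn => (h n hn).trans (h' n hn) }

/-- The table of the 26 classes. The entry `[a, b, c, d, e]` stands for the pattern `abcd-e`; of a
pattern and its complement only the lexicographically smaller one is recorded. -/
def classTable : List (List (List ℕ)) :=
  [
    /- A -/ [[1, 2, 5, 4, 3], [1, 3, 5, 4, 2]],
    /- B -/ [[1, 4, 5, 3, 2], [1, 5, 4, 3, 2]],
    /- C -/ [[2, 1, 3, 5, 4], [2, 1, 4, 5, 3]],
    /- D -/ [[1, 5, 3, 4, 2]],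
    /- E -/ [[2, 3, 1, 5, 4]],
    /- F -/ [[1, 2, 4, 3, 5], [1, 2, 5, 3, 4], [2, 1, 3, 4, 5], [2, 3, 5, 4, 1],
      [3, 1, 4, 5, 2], [3, 2, 4, 5, 1]],
    /- G -/ [[3, 1, 2, 5, 4], [3, 2, 1, 5, 4]],
    /- H -/ [[1, 5, 2, 3, 4]],
    /- I -/ [[3, 2, 5, 1, 4]],
    /- J -/ [[2, 1, 5, 4, 3]],
    /- K -/ [[1, 4, 3, 5, 2]],
    /- L -/ [[3, 1, 2, 4, 5], [3, 2, 1, 4, 5], [2, 5, 4, 3, 1], [2, 4, 5, 3, 1],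
      [2, 3, 4, 1, 5], [2, 4, 3, 1, 5], [1, 3, 4, 2, 5], [1, 4, 3, 2, 5],
      [1, 3, 5, 2, 4], [1, 4, 5, 2, 3], [1, 5, 3, 2, 4], [1, 5, 4, 2, 3],
      [2, 5, 3, 1, 4], [2, 5, 4, 1, 3], [2, 3, 5, 1, 4], [2, 4, 5, 1, 3]],
    /- M -/ [[2, 1, 5, 3, 4], [3, 1, 5, 4, 2]],
    /- N -/ [[2, 5, 1, 3, 4]],
    /- O -/ [[1, 5, 2, 4, 3]],
    /- P -/ [[2, 4, 1, 5, 3]],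
    /- Q -/ [[1, 3, 2, 5, 4]],
    /- R -/ [[1, 4, 2, 3, 5], [2, 3, 1, 4, 5], [2, 5, 3, 4, 1], [3, 2, 4, 1, 5]],
    /- S -/ [[2, 1, 4, 3, 5], [3, 2, 5, 4, 1]],
    /- T -/ [[3, 1, 5, 2, 4]],
    /- U -/ [[1, 4, 2, 5, 3]],
    /- V -/ [[1, 3, 2, 4, 5], [2, 4, 3, 5, 1]],
    /- W -/ [[2, 5, 1, 4, 3]],
    /- X -/ [[2, 4, 1, 3, 5], [3, 1, 4, 2, 5]],
    /- Y -/ [[1, 2, 3, 5, 4], [1, 2, 4, 5, 3], [1, 3, 4, 5, 2]],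
    /- Z -/ [[1, 2, 3, 4, 5], [2, 3, 4, 5, 1]]]

/-- The set of patterns described by a row of the table: the recorded patterns and their
complements. (A quasi-consecutive pattern is determined by its word.) -/
def tableClass (row : List (List ℕ)) : Set (QuasiConsecutivePattern 5) :=
  {p | p.1.word ∈ row ∨ p.1.complement.word ∈ row}

/-! ### Sums over Lehmer codes -/

/-- The order embedding of `ℕ` into `ℕ` whose image omits exactly `x`. -/
def skip (x y : ℕ) : ℕ := if y < x then y else y + 1

/-- The sum of `φ` over all lists `[c₀, …, c_{j-1}]` with `c_i < N - i`, i.e. over the Lehmer codes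
of the injective sequences of length `j` in `{0, …, N - 1}`. -/
def codeSum : ℕ → ℕ → (List ℕ → ℕ) → ℕ
  | _, 0, φ => φ []
  | N, j + 1, φ => ∑ x ∈ Finset.range N, codeSum (N - 1) j (fun c => φ (x :: c))

/-- The list `c` satisfies `c_i < N - i` for all `i`. -/
def IsCode : ℕ → List ℕ → Prop
  | _, [] => True
  | N, x :: c => x < N ∧ IsCode (N - 1) c

/-- The injective sequence with a given Lehmer code. -/
def decode : List ℕ → List ℕ
  | [] => []
  | x :: c => x :: (decode c).map (skip x)

theorem skip_lt_skip {x a b : ℕ} : skip x a < skip x b ↔ a < b := by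
  unfold skip; split_ifs <;> omega

theorem skip_strictMono (x : ℕ) : StrictMono (skip x) := fun _ _ h => skip_lt_skip.2 h

theorem exists_skip_eq {x v : ℕ} (h : v ≠ x) : ∃ u, skip x u = v := by
  rcases Nat.lt_or_gt_of_ne h with h | h
  · exact ⟨v, by simp [skip, h]⟩
  · exact ⟨v - 1, by unfold skip; split_ifs <;> omega⟩

theorem skip_lt_succ_iff {x u N : ℕ} (hx : x < N + 1) : skip x u < N + 1 ↔ u < N := by
  unfold skip; split_ifs <;> omega

theorem codeSum_congr {j : ℕ} : ∀ {N : ℕ} {φ ψ : List ℕ → ℕ},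
    (∀ c, c.length = j → IsCode N c → φ c = ψ c) → codeSum N j φ = codeSum N j ψ := by
  induction j with
  | zero => intro N φ ψ h; exact h [] rfl trivial
  | succ j ih =>
    intro N φ ψ h
    refine Finset.sum_congr rfl fun x hx => ih fun c hc hv => h _ (by simp [hc]) ⟨?_, hv⟩
    simpa using hx

theorem codeSum_add (j : ℕ) : ∀ (N : ℕ) (φ ψ : List ℕ → ℕ),
    codeSum N j (fun c => φ c + ψ c) = codeSum N j φ + codeSum N j ψ := by
  induction j with
  | zero => intro N φ ψ; rfl
  | succ j ih => intro N φ ψ; simp only [codeSum, ih, Finset.sum_add_distrib]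

theorem codeSum_mul (j : ℕ) : ∀ (N a : ℕ) (φ : List ℕ → ℕ),
    codeSum N j (fun c => a * φ c) = a * codeSum N j φ := by
  induction j with
  | zero => intro N a φ; rfl
  | succ j ih => intro N a φ; simp only [codeSum, ih, Finset.mul_sum]

theorem codeSum_zero (N j : ℕ) : codeSum N j (fun _ => 0) = 0 := by
  simpa using codeSum_mul j N 0 (fun _ => 0)

/-- Prepending a first entry to an injective sequence. -/
def consEmbedding {j N : ℕ} (p : Fin (N + 1) × (Fin j ↪ Fin N)) : Fin (j + 1) ↪ Fin (N + 1) where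
  toFun := Fin.cons p.1 (fun i => p.1.succAbove (p.2 i))
  inj' := by
    rw [Fin.cons_injective_iff]
    refine ⟨?_, Fin.succAbove_right_injective.comp p.2.injective⟩
    rintro ⟨i, hi⟩
    exact Fin.succAbove_ne _ _ hi

/-- This is one step of the Lehmer correspondence: an injective sequence amounts to its first entry
together with the standardisation of the rest inside the remaining values. -/
theorem consEmbedding_bijective {j N : ℕ} :
    Function.Bijective (consEmbedding : Fin (N + 1) × (Fin j ↪ Fin N) → _) := by
  constructor
  · rintro ⟨x, f⟩ ⟨y, g⟩ h
    have h' : ∀ i, (Fin.cons x (fun i => x.succAbove (f i)) : Fin (j + 1) → Fin (N + 1)) i =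
      (Fin.cons y (fun i => y.succAbove (g i)) : Fin (j + 1) → Fin (N + 1)) i :=
      fun i => DFunLike.congr_fun h i
    have h0 : x = y := h' 0
    subst h0
    refine Prod.ext rfl (DFunLike.ext _ _ fun i => ?_)
    have := h' i.succ
    simp only [Fin.cons_succ] at this
    exact Fin.succAbove_right_injective this
  · intro f
    have h : ∀ i : Fin j, ∃ y, (f 0).succAbove y = f i.succ := fun i =>
      Fin.exists_succAbove_eq fun h => Fin.succ_ne_zero i (f.injective h)
    choose g hg using h
    refine ⟨⟨f 0, ⟨g, fun a b hab => ?_⟩⟩, ?_⟩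
    · have := hg a
      rw [hab, hg b] at this
      exact (Fin.succ_injective _ (f.injective this)).symm
    · refine DFunLike.ext _ _ fun i => ?_
      refine Fin.cases rfl (fun i => ?_) i
      exact hg i

theorem val_succAbove_eq_skip {N : ℕ} (x : Fin (N + 1)) (y : Fin N) :
    (x.succAbove y : ℕ) = skip x y := by
  unfold skip Fin.succAbove
  simp only [Fin.lt_def, Fin.val_castSucc]
  split_ifs <;> simp

/-- A sum over Lehmer codes is a sum over injective sequences. -/
theorem codeSum_decode (j : ℕ) : ∀ (N : ℕ) (ψ : List ℕ → ℕ),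
    codeSum N j (fun c => ψ (decode c)) =
      ∑ f : Fin j ↪ Fin N, ψ (List.ofFn fun i => (f i : ℕ)) := by
  induction j with
  | zero =>
    intro N ψ
    simp [codeSum, decode]
  | succ j ih =>
    intro N ψ
    rcases N with _ | N
    · have : IsEmpty (Fin (j + 1) ↪ Fin 0) := ⟨fun f => (f 0).elim0⟩
      simp [codeSum]
    · rw [← Function.Bijective.sum_comp consEmbedding_bijective, Fintype.sum_prod_type]
      simp only [codeSum, Nat.add_sub_cancel, decode]
      rw [Finset.sum_range]
      refine Finset.sum_congr rfl fun x _ => ?_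
      rw [ih N (fun l => ψ (x :: l.map (skip x)))]
      refine Finset.sum_congr rfl fun f _ => ?_
      congr 1
      simp [consEmbedding, List.ofFn_succ, List.map_ofFn, val_succAbove_eq_skip, Function.comp_def]

/-! ### Weights -/

/-- The indicator function of the codes none of whose windows `x, y, z, w` of four consecutive
entries satisfies `B m x y z w`, where `m` is the length of the suffix that begins with `x`. -/
def avoidWeight (B : ℕ → ℕ → ℕ → ℕ → ℕ → Bool) : List ℕ → ℕ
  | x :: y :: z :: w :: c =>
    if B (c.length + 4) x y z w then 0 else avoidWeight B (y :: z :: w :: c)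
  | _ => 1

theorem avoidWeight_cons₄ (B : ℕ → ℕ → ℕ → ℕ → ℕ → Bool) (x y z w : ℕ) (c : List ℕ) :
    avoidWeight B (x :: y :: z :: w :: c) =
      if B (c.length + 4) x y z w then 0 else avoidWeight B (y :: z :: w :: c) := by
  rw [avoidWeight]

/-- The number of codes of length `n` that avoid `B`. -/
def avoidCount (B : ℕ → ℕ → ℕ → ℕ → ℕ → Bool) (n : ℕ) : ℕ := codeSum n n (avoidWeight B)

/-- `v, v'` compare in the same way as `a, a'`. -/
def sameOrder (a a' v v' : ℕ) : Bool :=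
  bif a.blt a' then v.blt v' else bif a'.blt a then v'.blt v else v.beq v'

/-- One if `a < b`, zero otherwise. -/
def ltBit (a b : ℕ) : ℕ := bif a.blt b then 1 else 0

/-- The values `v₁, v₂, v₃, v₄` compare in the same way as `a, b, c, d`. -/
def sameOrder₄ (a b c d v₁ v₂ v₃ v₄ : ℕ) : Bool :=
  sameOrder a b v₁ v₂ && (sameOrder b c v₂ v₃ && (sameOrder c d v₃ v₄ &&
    (sameOrder a c v₁ v₃ && (sameOrder b d v₂ v₄ && sameOrder a d v₁ v₄))))

/-- The value `v` compares with `v₁, v₂, v₃, v₄` in the same way as `e` with `a, b, c, d`. -/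
def sameOrderLast (a b c d e v₁ v₂ v₃ v₄ v : ℕ) : Bool :=
  sameOrder a e v₁ v && (sameOrder b e v₂ v && (sameOrder c e v₃ v && sameOrder d e v₄ v))

/-- The entries `x, y, z, w` of a code begin an occurrence of the consecutive pattern `abcd`. -/
def windowType (a b c d x y z w : ℕ) : Bool :=
  sameOrder₄ a b c d x (y + ltBit a b) (z + (ltBit a c + ltBit b c))
    (w + (ltBit a d + ltBit b d + ltBit c d))

/-- The entries `x, y, z, w` at the beginning of a code of length `m` begin an occurrence of
`abcd-e`. -/
def windowBad (a b c d e m x y z w : ℕ) : Bool :=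
  windowType a b c d x y z w &&
    (List.range m).any fun v =>
      sameOrderLast a b c d e x (y + ltBit a b) (z + (ltBit a c + ltBit b c))
        (w + (ltBit a d + ltBit b d + ltBit c d)) v

theorem sameOrder_iff {a a' v v' : ℕ} :
    sameOrder a a' v v' = true ↔ (v < v' ↔ a < a') ∧ (v' < v ↔ a' < a) := by
  unfold sameOrder
  rcases lt_trichotomy a a' with h | h | h
  · have h1 : Nat.blt a a' = true := by simpa using h
    simp [h1]; omega
  · subst h
    simp; omega
  · have h1 : Nat.blt a' a = true := by simpa using h
    have h2 : Nat.blt a a' = false := by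
      rw [← Bool.not_eq_true, Nat.blt_eq]; omega
    simp [h1, h2]; omega

theorem sameOrder_of_strictMono {f : ℕ → ℕ} (hf : StrictMono f) (a a' v v' : ℕ) :
    sameOrder a a' (f v) (f v') = sameOrder a a' v v' := by
  rw [Bool.eq_iff_iff, sameOrder_iff, sameOrder_iff, hf.lt_iff_lt, hf.lt_iff_lt]

theorem ltBit_of_lt {a b : ℕ} (h : a < b) : ltBit a b = 1 := by
  have : Nat.blt a b = true := by simpa using h
  simp [ltBit, this]

theorem ltBit_of_gt {a b : ℕ} (h : b < a) : ltBit a b = 0 := by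
  have : Nat.blt a b = false := by rw [← Bool.not_eq_true, Nat.blt_eq]; omega
  simp [ltBit, this]

/-- Omitting `x` raises `y` by one or not at all, and which of the two happens is exactly the
comparison with `x`. A prescribed order type therefore turns `skip` into a constant shift. -/
theorem sameOrder_skip_iff {a b x y : ℕ} (h : a ≠ b) :
    sameOrder a b x (skip x y) = true ↔ skip x y = y + ltBit a b := by
  rw [sameOrder_iff]
  rcases Nat.lt_or_gt_of_ne h with h | h
  · rw [ltBit_of_lt h]; unfold skip; split_ifs <;> omega
  · rw [ltBit_of_gt h]; unfold skip; split_ifs <;> omega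

theorem sameOrder_add_iff {a b x y : ℕ} (h : a ≠ b) :
    sameOrder a b x (y + ltBit a b) = true ↔ skip x y = y + ltBit a b := by
  rw [sameOrder_iff]
  rcases Nat.lt_or_gt_of_ne h with h | h
  · rw [ltBit_of_lt h]; unfold skip; split_ifs <;> omega
  · rw [ltBit_of_gt h]; unfold skip; split_ifs <;> omega

theorem sameOrder₄_of_strictMono {f : ℕ → ℕ} (hf : StrictMono f) (a b c d v₁ v₂ v₃ v₄ : ℕ) :
    sameOrder₄ a b c d (f v₁) (f v₂) (f v₃) (f v₄) = sameOrder₄ a b c d v₁ v₂ v₃ v₄ := by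
  simp only [sameOrder₄, sameOrder_of_strictMono hf]

theorem sameOrderLast_of_strictMono {f : ℕ → ℕ} (hf : StrictMono f) (a b c d e v₁ v₂ v₃ v₄ v : ℕ) :
    sameOrderLast a b c d e (f v₁) (f v₂) (f v₃) (f v₄) (f v) =
      sameOrderLast a b c d e v₁ v₂ v₃ v₄ v := by
  simp only [sameOrderLast, sameOrder_of_strictMono hf]

/-- If the values compare as `a, b, c, d` do, they arise from the code by constant shifts. -/
theorem skip_eq_of_sameOrder₄ {a b c d : ℕ} (h : [a, b, c, d].Nodup) {x y z w : ℕ}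
    (hT : sameOrder₄ a b c d x (skip x y) (skip x (skip y z)) (skip x (skip y (skip z w))) = true) :
    skip x y = y + ltBit a b ∧ skip x (skip y z) = z + (ltBit a c + ltBit b c) ∧
      skip x (skip y (skip z w)) = w + (ltBit a d + ltBit b d + ltBit c d) := by
  simp only [List.nodup_cons, List.mem_cons, not_or, List.not_mem_nil, not_false_eq_true] at h
  obtain ⟨⟨hab, hac, had, -⟩, ⟨hbc, hbd, -⟩, ⟨hcd, -⟩, -⟩ := h
  simp only [sameOrder₄, sameOrder_of_strictMono (skip_strictMono _), Bool.and_eq_true,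
    sameOrder_skip_iff hab, sameOrder_skip_iff hac, sameOrder_skip_iff had, sameOrder_skip_iff hbc,
    sameOrder_skip_iff hbd, sameOrder_skip_iff hcd] at hT
  omega

/-- The shifts are recognised as skips from the outside in: comparison with the first letter
identifies the outer `skip x`, which is then cancelled by monotonicity, and so on for `y` and `z`.
-/
theorem skip_eq_of_windowType {a b c d : ℕ} (h : [a, b, c, d].Nodup) {x y z w : ℕ}
    (hT : windowType a b c d x y z w = true) :
    skip x y = y + ltBit a b ∧ skip x (skip y z) = z + (ltBit a c + ltBit b c) ∧
      skip x (skip y (skip z w)) = w + (ltBit a d + ltBit b d + ltBit c d) := by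
  simp only [List.nodup_cons, List.mem_cons, not_or, List.not_mem_nil, not_false_eq_true] at h
  obtain ⟨⟨hab, hac, had, -⟩, ⟨hbc, hbd, -⟩, ⟨hcd, -⟩, -⟩ := h
  simp only [windowType, sameOrder₄, Bool.and_eq_true] at hT
  obtain ⟨h12, h23, h34, h13, h24, h14⟩ := hT
  rw [sameOrder_add_iff hab] at h12
  have e3 : z + (ltBit a c + ltBit b c) = (z + ltBit b c) + ltBit a c := by omega
  rw [e3] at h13 h23 h34
  rw [sameOrder_add_iff hac] at h13
  have e4 : w + (ltBit a d + ltBit b d + ltBit c d) =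
    ((w + ltBit c d) + ltBit b d) + ltBit a d := by omega
  rw [e4] at h14 h24 h34
  rw [sameOrder_add_iff had] at h14
  rw [← h12, ← h13, sameOrder_of_strictMono (skip_strictMono _), sameOrder_add_iff hbc] at h23
  rw [← h12, ← h14, sameOrder_of_strictMono (skip_strictMono _), sameOrder_add_iff hbd] at h24
  rw [← h13, ← h14, sameOrder_of_strictMono (skip_strictMono _), ← h23, ← h24,
    sameOrder_of_strictMono (skip_strictMono _), sameOrder_add_iff hcd] at h34
  rw [h34, h24, h14, h23, h13, h12]
  omega

theorem windowType_eq {a b c d : ℕ} (h : [a, b, c, d].Nodup) (x y z w : ℕ) :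
    windowType a b c d x y z w =
      sameOrder₄ a b c d x (skip x y) (skip x (skip y z)) (skip x (skip y (skip z w))) := by
  rw [Bool.eq_iff_iff]
  constructor
  · intro hT
    obtain ⟨h2, h3, h4⟩ := skip_eq_of_windowType h hT
    rw [h2, h3, h4]; exact hT
  · intro hT
    obtain ⟨h2, h3, h4⟩ := skip_eq_of_sameOrder₄ h hT
    rw [h2, h3, h4] at hT; exact hT

/-! ### Occurrences of patterns in lists -/

/-- The list `l` contains the pattern `abcd-e`. -/
def ListContains (a b c d e : ℕ) (l : List ℕ) : Prop :=
  ∃ v₁ v₂ v₃ v₄ r, (v₁ :: v₂ :: v₃ :: v₄ :: r) <:+ l ∧ sameOrder₄ a b c d v₁ v₂ v₃ v₄ = true ∧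
    ∃ v ∈ r, sameOrderLast a b c d e v₁ v₂ v₃ v₄ v = true

/-- The list `l` contains the consecutive pattern `abcd`. -/
def ListContainsConsecutive (a b c d : ℕ) (l : List ℕ) : Prop :=
  ∃ v₁ v₂ v₃ v₄, [v₁, v₂, v₃, v₄] <:+: l ∧ sameOrder₄ a b c d v₁ v₂ v₃ v₄ = true

theorem listContains_map {f : ℕ → ℕ} (hf : StrictMono f) (a b c d e : ℕ) (l : List ℕ) :
    ListContains a b c d e (l.map f) ↔ ListContains a b c d e l := by
  constructor
  · rintro ⟨v₁, v₂, v₃, v₄, r, ⟨p, hp⟩, hT, v, hv, hL⟩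
    obtain ⟨p', q, rfl, rfl, hq⟩ := List.map_eq_append_iff.1 hp.symm
    obtain ⟨v₁, q, rfl, rfl, hq₁⟩ := List.map_eq_cons_iff.1 hq
    obtain ⟨v₂, q, rfl, rfl, hq₂⟩ := List.map_eq_cons_iff.1 hq₁
    obtain ⟨v₃, q, rfl, rfl, hq₃⟩ := List.map_eq_cons_iff.1 hq₂
    obtain ⟨v₄, q, rfl, rfl, rfl⟩ := List.map_eq_cons_iff.1 hq₃
    obtain ⟨u, hu, rfl⟩ := List.mem_map.1 hv
    rw [sameOrder₄_of_strictMono hf] at hT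
    rw [sameOrderLast_of_strictMono hf] at hL
    exact ⟨_, _, _, _, q, ⟨p', rfl⟩, hT, u, hu, hL⟩
  · rintro ⟨v₁, v₂, v₃, v₄, r, ⟨p, rfl⟩, hT, v, hv, hL⟩
    refine ⟨f v₁, f v₂, f v₃, f v₄, r.map f, ⟨p.map f, by simp⟩, ?_, f v,
      List.mem_map_of_mem hv, ?_⟩
    · rwa [sameOrder₄_of_strictMono hf]
    · rwa [sameOrderLast_of_strictMono hf]

theorem listContainsConsecutive_map {f : ℕ → ℕ} (hf : StrictMono f) (a b c d : ℕ) (l : List ℕ) :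
    ListContainsConsecutive a b c d (l.map f) ↔ ListContainsConsecutive a b c d l := by
  constructor
  · rintro ⟨v₁, v₂, v₃, v₄, ⟨p, r, hp⟩, hT⟩
    rw [List.append_assoc] at hp
    obtain ⟨p', q, rfl, rfl, hq⟩ := List.map_eq_append_iff.1 hp.symm
    obtain ⟨v₁, q, rfl, rfl, hq₁⟩ := List.map_eq_cons_iff.1 hq
    obtain ⟨v₂, q, rfl, rfl, hq₂⟩ := List.map_eq_cons_iff.1 hq₁
    obtain ⟨v₃, q, rfl, rfl, hq₃⟩ := List.map_eq_cons_iff.1 hq₂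
    obtain ⟨v₄, q, rfl, rfl, rfl⟩ := List.map_eq_cons_iff.1 hq₃
    rw [sameOrder₄_of_strictMono hf] at hT
    exact ⟨_, _, _, _, ⟨p', q, by simp⟩, hT⟩
  · rintro ⟨v₁, v₂, v₃, v₄, ⟨p, r, rfl⟩, hT⟩
    refine ⟨f v₁, f v₂, f v₃, f v₄, ⟨p.map f, r.map f, by simp⟩, ?_⟩
    rwa [sameOrder₄_of_strictMono hf]

theorem listContains_cons {a b c d e x : ℕ} {l : List ℕ} :
    ListContains a b c d e (x :: l) ↔ ListContains a b c d e l ∨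
      ∃ v₂ v₃ v₄ r, l = v₂ :: v₃ :: v₄ :: r ∧ sameOrder₄ a b c d x v₂ v₃ v₄ = true ∧
        ∃ v ∈ r, sameOrderLast a b c d e x v₂ v₃ v₄ v = true := by
  constructor
  · rintro ⟨v₁, v₂, v₃, v₄, r, hs, hT, hv⟩
    rcases List.suffix_cons_iff.1 hs with h | h
    · obtain ⟨rfl, rfl⟩ := List.cons_eq_cons.1 h
      exact Or.inr ⟨_, _, _, _, rfl, hT, hv⟩
    · exact Or.inl ⟨_, _, _, _, _, h, hT, hv⟩
  · rintro (⟨v₁, v₂, v₃, v₄, r, hs, hT, hv⟩ | ⟨v₂, v₃, v₄, r, rfl, hT, hv⟩)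
    · exact ⟨_, _, _, _, _, hs.trans (List.suffix_cons _ _), hT, hv⟩
    · exact ⟨_, _, _, _, _, List.suffix_rfl, hT, hv⟩

theorem listContainsConsecutive_cons {a b c d x : ℕ} {l : List ℕ} :
    ListContainsConsecutive a b c d (x :: l) ↔ ListContainsConsecutive a b c d l ∨
      ∃ v₂ v₃ v₄ r, l = v₂ :: v₃ :: v₄ :: r ∧ sameOrder₄ a b c d x v₂ v₃ v₄ = true := by
  constructor
  · rintro ⟨v₁, v₂, v₃, v₄, hs, hT⟩
    rcases List.infix_cons_iff.1 hs with ⟨r, h⟩ | h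
    · simp only [List.cons_append, List.cons.injEq, List.nil_append] at h
      obtain ⟨rfl, rfl⟩ := h
      exact Or.inr ⟨_, _, _, _, rfl, hT⟩
    · exact Or.inl ⟨_, _, _, _, h, hT⟩
  · rintro (⟨v₁, v₂, v₃, v₄, hs, hT⟩ | ⟨v₂, v₃, v₄, r, rfl, hT⟩)
    · exact ⟨_, _, _, _, hs.trans (List.suffix_cons _ _).isInfix, hT⟩
    · exact ⟨_, _, _, _, ⟨[], r, by simp⟩, hT⟩

theorem sameOrder_comm (a a' v v' : ℕ) : sameOrder a' a v' v = sameOrder a a' v v' := by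
  rw [Bool.eq_iff_iff, sameOrder_iff, sameOrder_iff, and_comm]

theorem sameOrder₄_reverse (a b c d v₁ v₂ v₃ v₄ : ℕ) :
    sameOrder₄ d c b a v₄ v₃ v₂ v₁ = sameOrder₄ a b c d v₁ v₂ v₃ v₄ := by
  simp only [sameOrder₄, sameOrder_comm c d, sameOrder_comm b c, sameOrder_comm a b,
    sameOrder_comm b d, sameOrder_comm a c, sameOrder_comm a d]
  ac_rfl

theorem listContainsConsecutive_reverse {a b c d : ℕ} {l : List ℕ} :
    ListContainsConsecutive d c b a l.reverse ↔ ListContainsConsecutive a b c d l := by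
  have key : ∀ {a b c d : ℕ} {l : List ℕ}, ListContainsConsecutive a b c d l →
      ListContainsConsecutive d c b a l.reverse := by
    rintro a b c d l ⟨v₁, v₂, v₃, v₄, hs, hT⟩
    refine ⟨v₄, v₃, v₂, v₁, ?_, by rwa [sameOrder₄_reverse]⟩
    simpa using List.reverse_infix.2 hs
  exact ⟨fun h => by simpa using key h, key⟩

/-! ### Codes of permutations -/

theorem length_decode (c : List ℕ) : (decode c).length = c.length := by
  induction c with
  | nil => rfl
  | cons x c ih => simp [decode, ih]

/-- A code of full length decodes to a permutation. This is what makes the existence of a later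
letter independent of the rest of the code. -/
theorem mem_decode_iff {c : List ℕ} : ∀ {n : ℕ}, c.length = n → IsCode n c →
    ∀ v, v ∈ decode c ↔ v < n := by
  induction c with
  | nil => rintro n rfl - v; simp [decode]
  | cons x c ih =>
    rintro n rfl ⟨hx, hc⟩ v
    simp only [List.length_cons, Nat.add_sub_cancel] at hx hc
    simp only [decode, List.mem_cons, List.mem_map, ih rfl hc, List.length_cons]
    constructor
    · rintro (rfl | ⟨u, hu, rfl⟩)
      · exact hx
      · exact (skip_lt_succ_iff hx).2 hu
    · intro hv
      by_cases h : v = x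
      · exact Or.inl h
      · obtain ⟨u, rfl⟩ := exists_skip_eq h
        exact Or.inr ⟨u, (skip_lt_succ_iff hx).1 hv, rfl⟩

theorem decode_cons₄ (x y z w : ℕ) (c : List ℕ) :
    decode (x :: y :: z :: w :: c) = x :: skip x y :: skip x (skip y z) ::
      skip x (skip y (skip z w)) ::
        (decode c).map (fun u => skip x (skip y (skip z (skip w u)))) := by
  simp [decode, Function.comp_def]

/-- All values below the length occur in the decoded list, so searching the range for a last letter
is the same as searching the letters after the window. -/
theorem windowBad_iff {a b c d e : ℕ} (h : [a, b, c, d, e].Nodup) {x y z w : ℕ} {r : List ℕ}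
    (hr : IsCode (r.length + 4) (x :: y :: z :: w :: r)) :
    windowBad a b c d e (r.length + 4) x y z w = true ↔
      sameOrder₄ a b c d x (skip x y) (skip x (skip y z)) (skip x (skip y (skip z w))) = true ∧
      ∃ v ∈ (decode r).map (fun u => skip x (skip y (skip z (skip w u)))),
        sameOrderLast a b c d e x (skip x y) (skip x (skip y z)) (skip x (skip y (skip z w))) v
          = true := by
  have hmem := mem_decode_iff (by simp) hr
  have h4 : [a, b, c, d].Nodup := by
    have : [a, b, c, d] <+: [a, b, c, d, e] := ⟨[e], rfl⟩
    exact h.sublist this.sublist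
  rw [windowBad, Bool.and_eq_true, ← windowType_eq h4]
  refine and_congr_right fun hT => ?_
  obtain ⟨h2, h3, h4⟩ := skip_eq_of_windowType h4 hT
  rw [← h2, ← h3, ← h4, List.any_eq_true]
  simp only [List.mem_range]
  rw [decode_cons₄] at hmem
  simp only [List.mem_cons] at hmem
  constructor
  · rintro ⟨v, hv, hL⟩
    refine ⟨v, ?_, hL⟩
    simp only [List.nodup_cons, List.mem_cons, not_or, List.not_mem_nil, not_false_eq_true] at h
    simp only [sameOrderLast, Bool.and_eq_true, sameOrder_iff] at hL
    -- The value `v` cannot be one of the four window letters, since `e` differs from `a`, `b`, `c`,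
    -- `d` and so each comparison is strict.
    rcases (hmem v).2 hv with hv | hv | hv | hv | hv
    · omega
    · omega
    · omega
    · omega
    · exact hv
  · rintro ⟨v, hv, hL⟩
    exact ⟨v, (hmem v).1 (by tauto), hL⟩

theorem avoidWeight_of_length_lt {B : ℕ → ℕ → ℕ → ℕ → ℕ → Bool} {l : List ℕ}
    (hl : l.length < 4) : avoidWeight B l = 1 := by
  rcases l with _ | ⟨x, _ | ⟨y, _ | ⟨z, _ | ⟨w, r⟩⟩⟩⟩
  · rfl
  · rfl
  · rfl
  · rfl
  · simp at hl; omega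

-- Decoding applies the increasing map `skip x` to the tail, which preserves occurrences. Hence a
-- new first entry only adds the occurrences that begin with it.
open Classical in
theorem avoidWeight_windowBad {a b c d e : ℕ} (h : [a, b, c, d, e].Nodup) {l : List ℕ} :
    IsCode l.length l → avoidWeight (windowBad a b c d e) l =
      if ListContains a b c d e (decode l) then 0 else 1 := by
  induction l with
  | nil =>
    intro _
    simp [avoidWeight, decode, ListContains]
  | cons x l ih =>
    intro hl
    have hl' : IsCode l.length l := hl.2
    have ih := ih hl'
    have hc : ListContains a b c d e (decode (x :: l)) ↔ ListContains a b c d e (decode l) ∨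
        ∃ v₂ v₃ v₄ r, (decode l).map (skip x) = v₂ :: v₃ :: v₄ :: r ∧
          sameOrder₄ a b c d x v₂ v₃ v₄ = true ∧
          ∃ v ∈ r, sameOrderLast a b c d e x v₂ v₃ v₄ v = true := by
      rw [decode, listContains_cons, listContains_map (skip_strictMono _)]
    by_cases hlen : ∃ y z w r, l = y :: z :: w :: r
    · obtain ⟨y, z, w, r, rfl⟩ := hlen
      have hd := decode_cons₄ x y z w r
      rw [decode, List.cons.injEq] at hd
      rw [hd.2] at hc
      have hb := windowBad_iff h (r := r) hl
      rw [avoidWeight]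
      by_cases hB : windowBad a b c d e (r.length + 4) x y z w = true
      · rw [if_pos hB, if_pos]
        exact hc.2 (Or.inr ⟨_, _, _, _, rfl, hb.1 hB⟩)
      · rw [if_neg hB, ih]
        have : ListContains a b c d e (decode (x :: y :: z :: w :: r)) ↔
            ListContains a b c d e (decode (y :: z :: w :: r)) := by
          rw [hc]
          refine ⟨fun h' => h'.resolve_right ?_, Or.inl⟩
          rintro ⟨v₂, v₃, v₄, r', he, hT⟩
          simp only [List.cons.injEq] at he
          obtain ⟨rfl, rfl, rfl, rfl⟩ := he
          exact hB (hb.2 hT)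
        simp only [this]
    · have hlen : l.length < 3 := by
        rcases l with _ | ⟨y, _ | ⟨z, _ | ⟨w, r⟩⟩⟩
        · simp
        · simp
        · simp
        · exact absurd ⟨y, z, w, r, rfl⟩ hlen
      have hw : avoidWeight (windowBad a b c d e) (x :: l) = 1 := avoidWeight_of_length_lt (by simp; omega)
      have hw' : avoidWeight (windowBad a b c d e) l = 1 := avoidWeight_of_length_lt (by omega)
      rw [hw.trans hw'.symm, ih]
      have : ListContains a b c d e (decode (x :: l)) ↔ ListContains a b c d e (decode l) := by
        rw [hc]
        refine ⟨fun h' => h'.resolve_right ?_, Or.inl⟩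
        rintro ⟨v₂, v₃, v₄, r, he, -⟩
        have := congrArg List.length he
        simp only [List.length_map, length_decode, List.length_cons] at this
        omega
      simp only [this]

/-- The indicator function of the codes none of whose windows has type `abcd`. -/
def typeWeight (T : ℕ → ℕ → ℕ → ℕ → Bool) : List ℕ → ℕ :=
  avoidWeight fun _ => T

open Classical in
theorem typeWeight_windowType {a b c d : ℕ} (h : [a, b, c, d].Nodup) (l : List ℕ) :
    typeWeight (windowType a b c d) l =
      if ListContainsConsecutive a b c d (decode l) then 0 else 1 := by
  unfold typeWeight
  induction l with
  | nil => simp [avoidWeight, decode, ListContainsConsecutive]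
  | cons x l ih =>
    have hc : ListContainsConsecutive a b c d (decode (x :: l)) ↔
        ListContainsConsecutive a b c d (decode l) ∨
        ∃ v₂ v₃ v₄ r, (decode l).map (skip x) = v₂ :: v₃ :: v₄ :: r ∧
          sameOrder₄ a b c d x v₂ v₃ v₄ = true := by
      rw [decode, listContainsConsecutive_cons, listContainsConsecutive_map (skip_strictMono _)]
    by_cases hlen : ∃ y z w r, l = y :: z :: w :: r
    · obtain ⟨y, z, w, r, rfl⟩ := hlen
      have hd := decode_cons₄ x y z w r
      rw [decode, List.cons.injEq] at hd
      rw [hd.2] at hc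
      have hb := windowType_eq h x y z w
      rw [avoidWeight]
      by_cases hB : windowType a b c d x y z w = true
      · rw [if_pos hB, if_pos]
        exact hc.2 (Or.inr ⟨_, _, _, _, rfl, hb ▸ hB⟩)
      · rw [if_neg hB, ih]
        have : ListContainsConsecutive a b c d (decode (x :: y :: z :: w :: r)) ↔
            ListContainsConsecutive a b c d (decode (y :: z :: w :: r)) := by
          rw [hc]
          refine ⟨fun h' => h'.resolve_right ?_, Or.inl⟩
          rintro ⟨v₂, v₃, v₄, r', he, hT⟩
          simp only [List.cons.injEq] at he
          obtain ⟨rfl, rfl, rfl, rfl⟩ := he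
          exact hB (hb ▸ hT)
        simp only [this]
    · have hlen : l.length < 3 := by
        rcases l with _ | ⟨y, _ | ⟨z, _ | ⟨w, r⟩⟩⟩
        · simp
        · simp
        · simp
        · exact absurd ⟨y, z, w, r, rfl⟩ hlen
      have hw : avoidWeight (fun _ => windowType a b c d) (x :: l) = 1 := avoidWeight_of_length_lt (by simp; omega)
      have hw' : avoidWeight (fun _ => windowType a b c d) l = 1 := avoidWeight_of_length_lt (by omega)
      rw [hw.trans hw'.symm, ih]
      have : ListContainsConsecutive a b c d (decode (x :: l)) ↔
          ListContainsConsecutive a b c d (decode l) := by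
        rw [hc]
        refine ⟨fun h' => h'.resolve_right ?_, Or.inl⟩
        rintro ⟨v₂, v₃, v₄, r, he, -⟩
        have := congrArg List.length he
        simp only [List.length_map, length_decode, List.length_cons] at this
        omega
      simp only [this]

theorem listContains_iff_getElem {a b c d e : ℕ} {l : List ℕ} :
    ListContains a b c d e l ↔ ∃ (k j : ℕ) (hkj : k + 4 ≤ j) (hj : j < l.length),
      sameOrder₄ a b c d (l[k]'(by omega)) (l[k + 1]'(by omega)) (l[k + 2]'(by omega))
        (l[k + 3]'(by omega)) = true ∧
      sameOrderLast a b c d e (l[k]'(by omega)) (l[k + 1]'(by omega)) (l[k + 2]'(by omega))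
        (l[k + 3]'(by omega)) l[j] = true := by
  constructor
  · rintro ⟨v₁, v₂, v₃, v₄, r, ⟨q, rfl⟩, hT, v, hv, hL⟩
    obtain ⟨t, ht, rfl⟩ := List.getElem_of_mem hv
    refine ⟨q.length, q.length + 4 + t, by omega, by simp; omega, ?_⟩
    have : q.length + 4 + t - q.length = t + 1 + 1 + 1 + 1 := by omega
    simp only [List.getElem_append_right, Nat.le_add_right, Nat.le_refl, Nat.sub_self,
      Nat.add_sub_cancel_left, List.getElem_cons_zero, List.getElem_cons_succ, Nat.add_assoc]
    simp only [Nat.add_comm 4 t, List.getElem_cons_succ]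
    exact ⟨hT, hL⟩
  · rintro ⟨k, j, hkj, hj, hT, hL⟩
    refine ⟨_, _, _, _, l.drop (k + 4), ?_, hT, l[j], ?_, hL⟩
    · have : l.drop k = l[k] :: l[k + 1] :: l[k + 2] :: l[k + 3] :: l.drop (k + 4) := by
        rw [List.drop_eq_getElem_cons (by omega), List.drop_eq_getElem_cons (by omega),
          List.drop_eq_getElem_cons (by omega), List.drop_eq_getElem_cons (by omega)]
      rw [← this]
      exact List.drop_suffix _ _
    · rw [List.mem_iff_getElem]
      exact ⟨j - (k + 4), by simp; omega, by simp only [List.getElem_drop]; congr 1; omega⟩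

namespace VincularPattern

/-- The `i`-th letter of a pattern of length five, with letters `1, …, 5`. -/
def letter (p : VincularPattern 5) (i : Fin 5) : ℕ := (p.perm i : ℕ) + 1

theorem word_eq (p : VincularPattern 5) :
    p.word = [p.letter 0, p.letter 1, p.letter 2, p.letter 3, p.letter 4] := by
  simp [word, letter, List.ofFn_succ]

theorem word_nodup (p : VincularPattern 5) : p.word.Nodup := by
  rw [word, List.nodup_ofFn]
  intro i j h
  exact p.perm.injective (Fin.ext (by simpa using h))

/-- The adjacencies leave only two free indices, the start of the block of four and the position of
the last letter. -/
theorem containedIn_iff {p : VincularPattern 5} (hp : p.IsQuasiConsecutive) {n : ℕ}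
    (π : Equiv.Perm (Fin n)) : p.ContainedIn π ↔
      ListContains (p.letter 0) (p.letter 1) (p.letter 2) (p.letter 3) (p.letter 4)
        (List.ofFn fun i => (π i : ℕ)) := by
  rw [listContains_iff_getElem]
  simp only [List.length_ofFn, List.getElem_ofFn]
  have hlt : ∀ i j, p.letter i < p.letter j ↔ p.perm i < p.perm j := by
    intro i j; rw [letter, letter, Fin.lt_def]; omega
  constructor
  · rintro ⟨i, hi, hiso, hadj⟩
    have h1 : (i 1 : ℕ) = i 0 + 1 := hadj ⟨0, by omega⟩ ((hp _).2 (by simp))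
    have h2 : (i 2 : ℕ) = i 0 + 2 := by
      have : (i 2 : ℕ) = i 1 + 1 := hadj ⟨1, by omega⟩ ((hp _).2 (by simp))
      omega
    have h3 : (i 3 : ℕ) = i 0 + 3 := by
      have : (i 3 : ℕ) = i 2 + 1 := hadj ⟨2, by omega⟩ ((hp _).2 (by simp))
      omega
    have h34 : i 3 < i 4 := hi (by decide)
    have h4 : (i 0 : ℕ) + 4 ≤ i 4 := by rw [Fin.lt_def] at h34; omega
    refine ⟨i 0, i 4, h4, (i 4).2, ?_⟩
    have e1 : (⟨i 0 + 1, by omega⟩ : Fin n) = i 1 := Fin.ext h1.symm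
    have e2 : (⟨i 0 + 2, by omega⟩ : Fin n) = i 2 := Fin.ext h2.symm
    have e3 : (⟨i 0 + 3, by omega⟩ : Fin n) = i 3 := Fin.ext h3.symm
    simp only [e1, e2, e3, Fin.eta, sameOrder₄, sameOrderLast, Bool.and_eq_true, sameOrder_iff,
      hlt, Fin.val_fin_lt]
    exact ⟨⟨⟨hiso 0 1, hiso 1 0⟩, ⟨hiso 1 2, hiso 2 1⟩, ⟨hiso 2 3, hiso 3 2⟩,
      ⟨hiso 0 2, hiso 2 0⟩, ⟨hiso 1 3, hiso 3 1⟩, hiso 0 3, hiso 3 0⟩,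
      ⟨hiso 0 4, hiso 4 0⟩, ⟨hiso 1 4, hiso 4 1⟩, ⟨hiso 2 4, hiso 4 2⟩, hiso 3 4, hiso 4 3⟩
  · rintro ⟨k, j, hkj, hj, hT, hL⟩
    refine ⟨![⟨k, by omega⟩, ⟨k + 1, by omega⟩, ⟨k + 2, by omega⟩, ⟨k + 3, by omega⟩, ⟨j, hj⟩],
      ?_, ?_, ?_⟩
    · rw [Fin.strictMono_iff_lt_succ]
      intro i
      fin_cases i <;> simp [Fin.lt_def]
      omega
    · simp only [sameOrder₄, sameOrderLast, Bool.and_eq_true, sameOrder_iff,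
        hlt, Fin.val_fin_lt] at hT hL
      obtain ⟨h01, h12, h23, h02, h13, h03⟩ := hT
      obtain ⟨h04, h14, h24, h34⟩ := hL
      have hirr : ∀ (u : Fin n) (v : Fin 5), u < u ↔ v < v := fun u v =>
        iff_of_false (lt_irrefl _) (lt_irrefl _)
      intro i j
      match i, j with
      | 0, 0 => exact hirr _ _
      | 0, 1 => exact h01.1
      | 0, 2 => exact h02.1
      | 0, 3 => exact h03.1
      | 0, 4 => exact h04.1
      | 1, 0 => exact h01.2
      | 1, 1 => exact hirr _ _
      | 1, 2 => exact h12.1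
      | 1, 3 => exact h13.1
      | 1, 4 => exact h14.1
      | 2, 0 => exact h02.2
      | 2, 1 => exact h12.2
      | 2, 2 => exact hirr _ _
      | 2, 3 => exact h23.1
      | 2, 4 => exact h24.1
      | 3, 0 => exact h03.2
      | 3, 1 => exact h13.2
      | 3, 2 => exact h23.2
      | 3, 3 => exact hirr _ _
      | 3, 4 => exact h34.1
      | 4, 0 => exact h04.2
      | 4, 1 => exact h14.2
      | 4, 2 => exact h24.2
      | 4, 3 => exact h34.2
      | 4, 4 => exact hirr _ _
    · intro j hj
      have := (hp j).1 hj
      fin_cases j <;> first | rfl | (simp at this)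

theorem ncard_avoiders {p : VincularPattern 5} (hp : p.IsQuasiConsecutive) (n : ℕ) :
    (p.avoiders n).ncard = avoidCount
      (windowBad (p.letter 0) (p.letter 1) (p.letter 2) (p.letter 3) (p.letter 4)) n := by
  classical
  have hnd := p.word_nodup
  rw [word_eq] at hnd
  rw [avoidCount, codeSum_congr (ψ := fun c => if ListContains (p.letter 0) (p.letter 1)
    (p.letter 2) (p.letter 3) (p.letter 4) (decode c) then 0 else 1)
    (fun c hc hv => avoidWeight_windowBad hnd (by rwa [hc]))]
  rw [codeSum_decode n n (fun l => if ListContains (p.letter 0) (p.letter 1)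
    (p.letter 2) (p.letter 3) (p.letter 4) l then 0 else 1)]
  -- Injective sequences of length `n` in `n` values are permutations.
  rw [← (Equiv.embeddingEquivOfFinite (Fin n)).symm.sum_comp]
  have : ∀ π : Equiv.Perm (Fin n), (List.ofFn fun i =>
      (((Equiv.embeddingEquivOfFinite (Fin n)).symm π) i : ℕ)) = List.ofFn fun i => (π i : ℕ) :=
    fun π => rfl
  simp only [this, ← containedIn_iff hp]
  have hite : ∀ π : Equiv.Perm (Fin n), (if p.ContainedIn π then 0 else 1) =
      if ¬ p.ContainedIn π then 1 else 0 := fun π => (ite_not ..).symm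
  simp only [hite]
  rw [← Finset.card_filter, Set.ncard_eq_toFinset_card']
  congr 1
  ext π
  rw [Set.mem_toFinset]
  simp [avoiders]

theorem ncard_avoiders_complement (p : VincularPattern 5) (n : ℕ) :
    (p.complement.avoiders n).ncard = (p.avoiders n).ncard := by
  have hrev : ∀ π : Equiv.Perm (Fin n),
      p.complement.ContainedIn (π.trans Fin.revPerm) ↔ p.ContainedIn π := by
    intro π
    refine exists_congr fun i => and_congr_right fun _ => and_congr_left fun _ => ?_
    simp only [OrderIsomorphic, complement, Equiv.trans_apply, Fin.revPerm_apply, Fin.rev_lt_rev]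
    -- Reversing the values on both sides reverses every comparison, which only exchanges the two
    -- indices.
    exact forall_comm
  have : p.complement.avoiders n = (fun π : Equiv.Perm (Fin n) => π.trans Fin.revPerm) ''
      p.avoiders n := by
    ext π
    simp only [Set.mem_image, avoiders, Set.mem_ofPred_eq]
    constructor
    · intro h
      refine ⟨π.trans Fin.revPerm, ?_, ?_⟩
      · rw [← hrev]
        convert h using 2
        ext i; simp
      · ext i; simp
    · rintro ⟨ρ, h, rfl⟩
      rwa [hrev]
  rw [this, Set.ncard_image_of_injective]
  intro π ρ h
  ext i
  have := congrArg (fun σ : Equiv.Perm (Fin n) => Fin.rev (σ i)) h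
  simpa using congrArg Fin.val this

end VincularPattern

/-! ### Evaluation by dynamic programming -/

/-- `List.mapIdx` with indices that begin at `i`. -/
def mapFrom {α β : Type*} (f : ℕ → α → β) : ℕ → List α → List β
  | _, [] => []
  | i, a :: l => f i a :: mapFrom f (i + 1) l

/-- The sum of `v` over the entries `v` of a list, at indices `i` with `q i = false`. -/
def sumUnless (q : ℕ → Bool) : ℕ → List ℕ → ℕ
  | _, [] => 0
  | i, v :: l => bif q i then sumUnless q (i + 1) l else v + sumUnless q (i + 1) l

/-- From the table of the numbers of avoiding codes of length `k + 3` with given first three entries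
to the table for length `k + 4`, given a necessary condition `q` for `B`. -/
def tableStep (B : ℕ → ℕ → ℕ → ℕ → ℕ → Bool) (q : ℕ → ℕ → ℕ → Bool) (k : ℕ)
    (t : List (List (List ℕ))) : List (List (List ℕ)) :=
  (List.range (k + 4)).map fun x =>
    mapFrom (fun y ly => mapFrom (fun z lz =>
      bif q x y z then sumUnless (B (k + 4) x y z) 0 lz else lz.sum) 0 ly) 0 t

/-- The table of the numbers of avoiding codes of length `k + 3` with given first three entries. -/
def countTable (B : ℕ → ℕ → ℕ → ℕ → ℕ → Bool) (q : ℕ → ℕ → ℕ → Bool) :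
    ℕ → List (List (List ℕ))
  | 0 => [[[1], [1]], [[1], [1]], [[1], [1]]]
  | k + 1 => tableStep B q k (countTable B q k)

theorem mapFrom_map_range {α β : Type*} (f : ℕ → α → β) (g : ℕ → α) (n : ℕ) :
    mapFrom f 0 ((List.range n).map g) = (List.range n).map fun i => f i (g i) := by
  have key : ∀ i n, mapFrom f i ((List.range' i n).map g) =
      (List.range' i n).map fun i => f i (g i) := by
    intro i n
    induction n generalizing i with
    | zero => rfl
    | succ n ih => simp [List.range'_succ, mapFrom, ih]
  simpa [List.range_eq_range'] using key 0 n

theorem sumUnless_map_range (q : ℕ → Bool) (g : ℕ → ℕ) (n : ℕ) :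
    sumUnless q 0 ((List.range n).map g) = ∑ i ∈ Finset.range n, if q i then 0 else g i := by
  have key : ∀ i n, sumUnless q i ((List.range' i n).map g) =
      ∑ j ∈ Finset.range n, if q (i + j) then 0 else g (i + j) := by
    intro i n
    induction n generalizing i with
    | zero => rfl
    | succ n ih =>
      rw [Finset.sum_range_succ']
      simp only [List.range'_succ, List.map_cons, sumUnless, ih]
      cases q i <;> simp_all [add_comm, add_left_comm]
  simpa [List.range_eq_range'] using key 0 n

theorem sum_map_range (g : ℕ → ℕ) (n : ℕ) :
    ((List.range n).map g).sum = ∑ i ∈ Finset.range n, g i := by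
  rw [Finset.sum_range, ← List.sum_ofFn]
  simp [List.ofFn_eq_map, ← List.map_coe_finRange_eq_range, Function.comp_def]

/-- Prepending `x` creates just one new window, so the entry at `x, y, z` is a sum over `w` of old
entries at `y, z, w`. The test `q` spares the evaluation of `B` wherever the first three entries
already exclude a bad window. -/
theorem countTable_eq (B : ℕ → ℕ → ℕ → ℕ → ℕ → Bool) {q : ℕ → ℕ → ℕ → Bool}
    (hq : ∀ m x y z w, q x y z = false → B m x y z w = false) (k : ℕ) :
    countTable B q k = (List.range (k + 3)).map fun x => (List.range (k + 2)).map fun y =>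
      (List.range (k + 1)).map fun z => codeSum k k fun c => avoidWeight B (x :: y :: z :: c) := by
  induction k with
  | zero => rfl
  | succ k ih =>
    rw [countTable, tableStep, ih]
    refine List.map_congr_left fun x _ => ?_
    rw [mapFrom_map_range]
    refine List.map_congr_left fun y _ => ?_
    rw [mapFrom_map_range]
    refine List.map_congr_left fun z _ => ?_
    have hs : (bif q x y z then sumUnless (B (k + 4) x y z) 0 ((List.range (k + 1)).map fun w =>
        codeSum k k fun c => avoidWeight B (y :: z :: w :: c)) else ((List.range (k + 1)).map fun w =>
        codeSum k k fun c => avoidWeight B (y :: z :: w :: c)).sum) =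
        ∑ w ∈ Finset.range (k + 1), if B (k + 4) x y z w then 0 else
          codeSum k k fun c => avoidWeight B (y :: z :: w :: c) := by
      rw [sumUnless_map_range]
      cases hb : q x y z
      · simp [hq _ _ _ _ _ hb, sum_map_range]
      · rfl
    rw [hs, codeSum]
    refine Finset.sum_congr rfl fun w _ => ?_
    simp only [Nat.add_sub_cancel]
    rw [codeSum_congr (φ := fun c => avoidWeight B (x :: y :: z :: w :: c))
      (ψ := fun c => if B (k + 4) x y z w then 0 else avoidWeight B (y :: z :: w :: c))
      (fun c hc _ => by rw [avoidWeight, hc])]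
    split_ifs
    · rw [codeSum_zero]
    · rfl

theorem avoidCount_eq_sum_countTable (B : ℕ → ℕ → ℕ → ℕ → ℕ → Bool) {q : ℕ → ℕ → ℕ → Bool}
    (hq : ∀ m x y z w, q x y z = false → B m x y z w = false) (k : ℕ) :
    avoidCount B (k + 3) = ((countTable B q k).map fun l => (l.map List.sum).sum).sum := by
  rw [countTable_eq B hq]
  simp only [List.map_map, Function.comp_def, sum_map_range]
  rfl

/-! ### Patterns whose occurrences overlap in at most one entry -/

theorem codeSum_succ (n : ℕ) (φ : List ℕ → ℕ) :
    codeSum (n + 1) (n + 1) φ = ∑ x ∈ Finset.range (n + 1), codeSum n n fun c => φ (x :: c) := rfl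

/-- The number of avoiding codes of length `m + 1` that begin with `x`. -/
def firstCount (B : ℕ → ℕ → ℕ → ℕ → ℕ → Bool) (m x : ℕ) : ℕ :=
  codeSum m m fun c => avoidWeight B (x :: c)

theorem avoidCount_succ (B : ℕ → ℕ → ℕ → ℕ → ℕ → Bool) (m : ℕ) :
    avoidCount B (m + 1) = ∑ x ∈ Finset.range (m + 1), firstCount B m x := rfl

theorem firstCount_eq_of_lt {B B' : ℕ → ℕ → ℕ → ℕ → ℕ → Bool} {m : ℕ} (hm : m < 3) (x : ℕ) :
    firstCount B m x = firstCount B' m x :=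
  codeSum_congr fun c hc _ => by
    rw [avoidWeight_of_length_lt (by simp; omega), avoidWeight_of_length_lt (by simp; omega)]

theorem avoidCount_congr {B B' : ℕ → ℕ → ℕ → ℕ → ℕ → Bool} {n : ℕ}
    (h : ∀ m, m + 1 = n → ∀ x ≤ m, firstCount B m x = firstCount B' m x) :
    avoidCount B n = avoidCount B' n := by
  rcases n with _ | m
  · rfl
  · rw [avoidCount_succ, avoidCount_succ]
    refine Finset.sum_congr rfl fun x hx => h m rfl x ?_
    simpa [Nat.lt_succ_iff] using hx

/-- Two windows that satisfy `B` overlap in at most one entry. -/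
def NonOverlapping (B : ℕ → ℕ → ℕ → ℕ → ℕ → Bool) : Prop :=
  ∀ m m' x y z w t s, B m x y z w = true → B m' y z w t = false ∧ B m' z w t s = false

/-- The number of windows with given first and last entry. -/
def windowCount (B : ℕ → ℕ → ℕ → ℕ → ℕ → Bool) (m x w : ℕ) : ℕ :=
  ((Finset.range (m + 3) ×ˢ Finset.range (m + 2)).filter
    fun p => B (m + 4) x p.1 p.2 w = true).card

/-- After a bad window `x, y, z, w`, neither the window at `y` nor the one at `z` can be bad, so the
next constraint starts at `w`. -/
theorem NonOverlapping.avoidWeight_eq {B : ℕ → ℕ → ℕ → ℕ → ℕ → Bool} (h : NonOverlapping B)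
    {m x y z w : ℕ} (hB : B m x y z w = true) (c : List ℕ) :
    avoidWeight B (y :: z :: w :: c) = avoidWeight B (w :: c) := by
  rcases c with _ | ⟨t, _ | ⟨s, c⟩⟩
  · rfl
  · simp [avoidWeight, (h _ 4 _ _ _ _ t 0 hB).1]
  · simp [avoidWeight, (h _ (c.length + 1 + 4) _ _ _ _ t s hB).1,
      (h _ (c.length + 4) _ _ _ _ t s hB).2]

/-- Put `x` in front of every avoiding code of length `m + 3`. The results that fail are those whose
first window is bad, and for these only the part from `w` on is still constrained. -/
theorem NonOverlapping.firstCount_add {B : ℕ → ℕ → ℕ → ℕ → ℕ → Bool} (h : NonOverlapping B)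
    (m x : ℕ) : firstCount B (m + 3) x +
      ∑ w ∈ Finset.range (m + 1), windowCount B m x w * firstCount B m w =
        avoidCount B (m + 3) := by
  have h1 : ∀ w, windowCount B m x w * firstCount B m w =
      ∑ y ∈ Finset.range (m + 3), ∑ z ∈ Finset.range (m + 2),
        (if B (m + 4) x y z w then 1 else 0) * firstCount B m w := by
    intro w
    rw [windowCount, Finset.card_filter, Finset.sum_product, Finset.sum_mul]
    simp only [Finset.sum_mul]
  simp only [h1]
  rw [Finset.sum_comm]
  simp only [Finset.sum_comm (s := Finset.range (m + 1)) (t := Finset.range (m + 2))]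
  rw [firstCount, avoidCount]
  simp only [codeSum_succ, ← Finset.sum_add_distrib]
  refine Finset.sum_congr rfl fun y _ => Finset.sum_congr rfl fun z _ =>
    Finset.sum_congr rfl fun w _ => ?_
  rw [firstCount, ← codeSum_mul, ← codeSum_add]
  refine codeSum_congr fun c hc _ => ?_
  rw [avoidWeight, hc]
  by_cases hB : B (m + 4) x y z w = true
  · simp [hB, h.avoidWeight_eq hB]
  · simp [hB]

/-- The recursion `NonOverlapping.firstCount_add` sees `B` only through `windowCount`, so strong
induction on the length identifies the counts by first entry. -/
theorem avoidCount_eq_of_nonOverlapping {B B' : ℕ → ℕ → ℕ → ℕ → ℕ → Bool}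
    (h : NonOverlapping B) (h' : NonOverlapping B')
    (hc : ∀ m x w, x < m + 4 → w < m + 1 → windowCount B m x w = windowCount B' m x w) (n : ℕ) :
    avoidCount B n = avoidCount B' n := by
  have key : ∀ m, ∀ x ≤ m, firstCount B m x = firstCount B' m x := by
    intro m
    induction m using Nat.strong_induction_on with
    | _ m ih =>
      intro x hx
      rcases Nat.lt_or_ge m 3 with hm | hm
      · exact firstCount_eq_of_lt hm x
      · obtain ⟨m, rfl⟩ := Nat.exists_eq_add_of_le' hm
        have e1 := h.firstCount_add m x
        have e2 := h'.firstCount_add m x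
        have e3 : avoidCount B (m + 3) = avoidCount B' (m + 3) :=
          avoidCount_congr fun k hk y hy => ih k (by omega) y hy
        have e4 : ∑ w ∈ Finset.range (m + 1), windowCount B m x w * firstCount B m w =
            ∑ w ∈ Finset.range (m + 1), windowCount B' m x w * firstCount B' m w := by
          refine Finset.sum_congr rfl fun w hw => ?_
          rw [Finset.mem_range] at hw
          rw [hc m x w (by omega) hw, ih m (by omega) w (by omega)]
        omega
  exact avoidCount_congr fun m _ x hx => key m x hx

/-! ### Cyclic shifts -/

/-- Adding one to every entry of a code, modulo its number of possible values. -/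
def shiftCode : ℕ → List ℕ → List ℕ
  | _, [] => []
  | n, x :: c => (if x + 1 < n then x + 1 else 0) :: shiftCode (n - 1) c

theorem length_shiftCode (c : List ℕ) : ∀ n, (shiftCode n c).length = c.length := by
  induction c with
  | nil => intro n; rfl
  | cons x c ih => intro n; simp [shiftCode, ih]

theorem sum_range_shift (n : ℕ) (f : ℕ → ℕ) :
    ∑ x ∈ Finset.range n, f (if x + 1 < n then x + 1 else 0) = ∑ x ∈ Finset.range n, f x := by
  rcases n with _ | n
  · rfl
  · rw [Finset.sum_range_succ, Finset.sum_range_succ']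
    congr 1
    · refine Finset.sum_congr rfl fun x hx => ?_
      rw [Finset.mem_range] at hx
      rw [if_pos (by omega)]
    · rw [if_neg (by omega)]

theorem codeSum_shiftCode (j : ℕ) : ∀ (n : ℕ) (φ : List ℕ → ℕ),
    codeSum n j (fun c => φ (shiftCode n c)) = codeSum n j φ := by
  induction j with
  | zero => intro n φ; rfl
  | succ j ih =>
    intro n φ
    simp only [codeSum, shiftCode]
    rw [← sum_range_shift n fun x => codeSum (n - 1) j fun c => φ (x :: c)]
    exact Finset.sum_congr rfl fun x _ =>
      ih (n - 1) fun c => φ ((if x + 1 < n then x + 1 else 0) :: c)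

theorem avoidWeight_shiftCode {B B' : ℕ → ℕ → ℕ → ℕ → ℕ → Bool}
    (h : ∀ m x y z w, x < m + 4 → y < m + 3 → z < m + 2 → w < m + 1 →
      B' (m + 4) (if x + 1 < m + 4 then x + 1 else 0) (if y + 1 < m + 3 then y + 1 else 0)
        (if z + 1 < m + 2 then z + 1 else 0) (if w + 1 < m + 1 then w + 1 else 0) =
      B (m + 4) x y z w) (c : List ℕ) :
    IsCode c.length c → avoidWeight B' (shiftCode c.length c) = avoidWeight B c := by
  induction c with
  | nil => intro _; rfl
  | cons x c ih =>
    intro hc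
    have ih := ih hc.2
    rcases c with _ | ⟨y, _ | ⟨z, _ | ⟨w, c⟩⟩⟩
    · rfl
    · rfl
    · rfl
    · obtain ⟨hx, hy, hz, hw, -⟩ := hc
      simp only [List.length_cons, Nat.add_sub_cancel] at hx hy hz hw
      have hB := h c.length x y z w hx hy hz hw
      simp only [shiftCode, List.length_cons, Nat.add_sub_cancel] at ih ⊢
      simp only [avoidWeight] at ih ⊢
      rw [length_shiftCode, ih]
      simp only [← hB]

/-- The entries of a code vary independently, so rotating each of them within its own range permutes
the codes. -/
theorem avoidCount_eq_of_shift {B B' : ℕ → ℕ → ℕ → ℕ → ℕ → Bool}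
    (h : ∀ m x y z w, x < m + 4 → y < m + 3 → z < m + 2 → w < m + 1 →
      B' (m + 4) (if x + 1 < m + 4 then x + 1 else 0) (if y + 1 < m + 3 then y + 1 else 0)
        (if z + 1 < m + 2 then z + 1 else 0) (if w + 1 < m + 1 then w + 1 else 0) =
      B (m + 4) x y z w) (n : ℕ) : avoidCount B n = avoidCount B' n := by
  rw [avoidCount, avoidCount, ← codeSum_shiftCode n n (avoidWeight B')]
  refine (codeSum_congr fun c hc hv => ?_).symm
  subst hc
  exact avoidWeight_shiftCode h c hv

/-! ### Patterns whose last letter is the largest or the smallest one -/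

theorem skip_pos_iff {x y : ℕ} (hx : 0 < x) : 0 < skip x y ↔ 0 < y := by
  unfold skip; split_ifs <;> omega

/-- A larger later letter exists iff the maximum of the suffix is not in the window. In terms of the
code, no entry of the window is the largest possible one at its place. -/
theorem windowBad_top_iff {a b c d e : ℕ} (h : [a, b, c, d].Nodup) (ha : a < e) (hb : b < e)
    (hc : c < e) (hd : d < e) {m x y z w : ℕ} :
    windowBad a b c d e (m + 4) x y z w = true ↔ windowType a b c d x y z w = true ∧
      x < m + 3 ∧ y < m + 2 ∧ z < m + 1 ∧ w < m := by
  rw [windowBad, Bool.and_eq_true]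
  refine and_congr_right fun hT => ?_
  obtain ⟨h2, h3, h4⟩ := skip_eq_of_windowType h hT
  rw [← h2, ← h3, ← h4]
  have h5 : (((List.range (m + 4)).any fun v => sameOrderLast a b c d e x (skip x y)
      (skip x (skip y z)) (skip x (skip y (skip z w))) v) = true) ↔
      x < m + 3 ∧ skip x y < m + 3 ∧ skip x (skip y z) < m + 3 ∧
        skip x (skip y (skip z w)) < m + 3 := by
    simp only [List.any_eq_true, List.mem_range, sameOrderLast, Bool.and_eq_true, sameOrder_iff]
    constructor
    · rintro ⟨v, hv, h⟩
      omega
    · intro h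
      exact ⟨m + 3, by omega, by omega⟩
  rw [h5]
  refine and_congr_right fun hx => ?_
  rw [skip_lt_succ_iff hx, skip_lt_succ_iff hx, skip_lt_succ_iff hx]
  refine and_congr_right fun hy => ?_
  rw [skip_lt_succ_iff hy, skip_lt_succ_iff hy]
  exact and_congr_right fun hz => skip_lt_succ_iff hz

/-- A smaller later letter exists iff the minimum of the suffix is not in the window, that is, iff
no code entry of the window is zero. -/
theorem windowBad_bottom_iff {a b c d e : ℕ} (h : [a, b, c, d].Nodup) (ha : e < a) (hb : e < b)
    (hc : e < c) (hd : e < d) {m x y z w : ℕ} :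
    windowBad a b c d e (m + 4) x y z w = true ↔ windowType a b c d x y z w = true ∧
      0 < x ∧ 0 < y ∧ 0 < z ∧ 0 < w := by
  rw [windowBad, Bool.and_eq_true]
  refine and_congr_right fun hT => ?_
  obtain ⟨h2, h3, h4⟩ := skip_eq_of_windowType h hT
  rw [← h2, ← h3, ← h4]
  have h5 : (((List.range (m + 4)).any fun v => sameOrderLast a b c d e x (skip x y)
      (skip x (skip y z)) (skip x (skip y (skip z w))) v) = true) ↔
      0 < x ∧ 0 < skip x y ∧ 0 < skip x (skip y z) ∧ 0 < skip x (skip y (skip z w)) := by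
    simp only [List.any_eq_true, List.mem_range, sameOrderLast, Bool.and_eq_true, sameOrder_iff]
    constructor
    · rintro ⟨v, hv, h⟩
      omega
    · intro h
      exact ⟨0, by omega, by omega⟩
  rw [h5]
  refine and_congr_right fun hx => ?_
  rw [skip_pos_iff hx, skip_pos_iff hx, skip_pos_iff hx]
  refine and_congr_right fun hy => ?_
  rw [skip_pos_iff hy, skip_pos_iff hy]
  exact and_congr_right fun hz => skip_pos_iff hz

theorem windowType_succ (a b c d x y z w : ℕ) :
    windowType a b c d (x + 1) (y + 1) (z + 1) (w + 1) = windowType a b c d x y z w := by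
  simp only [windowType, Nat.add_right_comm _ 1]
  exact sameOrder₄_of_strictMono (f := fun v => v + 1) (fun _ _ h => Nat.succ_lt_succ h) ..

theorem sameOrder_succ (a a' v v' : ℕ) : sameOrder (a + 1) (a' + 1) v v' = sameOrder a a' v v' := by
  rw [Bool.eq_iff_iff, sameOrder_iff, sameOrder_iff]
  simp

theorem windowBad_succ (a b c d e : ℕ) :
    windowBad (a + 1) (b + 1) (c + 1) (d + 1) (e + 1) = windowBad a b c d e := by
  have hlt : ∀ a b, ltBit (a + 1) (b + 1) = ltBit a b := fun _ _ => rfl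
  ext m x y z w
  simp only [windowBad, windowType, sameOrder₄, sameOrderLast, sameOrder_succ, hlt]

/-- The patterns `abcd-e` with largest and with smallest letter `e` are Wilf-equivalent. -/
theorem avoidCount_top_eq_bottom {a b c d e : ℕ} (h : [a, b, c, d].Nodup) (h0 : 0 < a ∧ 0 < b ∧
    0 < c ∧ 0 < d) (he : a < e ∧ b < e ∧ c < e ∧ d < e) (n : ℕ) :
    avoidCount (windowBad a b c d e) n =
      avoidCount (windowBad (a + 1) (b + 1) (c + 1) (d + 1) 1) n := by
  rw [windowBad_succ]
  refine avoidCount_eq_of_shift (fun m x y z w hx hy hz hw => ?_) n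
  rw [Bool.eq_iff_iff, windowBad_top_iff h he.1 he.2.1 he.2.2.1 he.2.2.2,
    windowBad_bottom_iff h h0.1 h0.2.1 h0.2.2.1 h0.2.2.2]
  by_cases hlt : x < m + 3 ∧ y < m + 2 ∧ z < m + 1 ∧ w < m
  · rw [if_pos (by omega), if_pos (by omega), if_pos (by omega), if_pos (by omega),
      windowType_succ]
    simp [hlt]
  -- A maximal entry is rotated to zero, so the condition for a smallest last letter fails as well.
  · refine iff_of_false (fun h' => hlt ?_) (fun h' => hlt h'.2)
    obtain ⟨-, h1, h2, h3, h4⟩ := h'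
    split_ifs at h1 h2 h3 h4 <;> omega

/-- Splitting a code at its first entry that is as large as possible. -/
theorem codeSum_split_first_max (n : ℕ) : ∀ φ : List ℕ → ℕ, codeSum (n + 1) (n + 1) φ =
    ∑ j ∈ Finset.range (n + 1), codeSum n j fun l =>
      codeSum (n - j) (n - j) fun r => φ (l ++ (n - j) :: r) := by
  induction n with
  | zero => intro φ; rfl
  | succ n ih =>
    intro φ
    -- The largest first entry corresponds to an empty prefix, `j = 0`. Any other first entry is the
    -- first one of a prefix.
    rw [codeSum_succ, Finset.sum_range_succ, Finset.sum_range_succ' _ (n + 1)]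
    congr 1
    simp only [ih]
    rw [Finset.sum_comm]
    refine Finset.sum_congr rfl fun j _ => ?_
    simp only [codeSum, Nat.add_sub_cancel, Nat.add_sub_add_right, List.cons_append]

/-- The entry `r.length` is maximal at its place and stands for the maximum of the permutation. A
window before it is bad iff it has type `abcd`, because the maximum can serve as the last letter. A
window containing it is never bad. -/
theorem avoidWeight_append_max {a b c d e : ℕ} (h : [a, b, c, d].Nodup)
    (he : a < e ∧ b < e ∧ c < e ∧ d < e) (l r : List ℕ) : IsCode (l.length + r.length) l →
    avoidWeight (windowBad a b c d e) (l ++ r.length :: r) =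
      typeWeight (windowType a b c d) l * avoidWeight (windowBad a b c d e) r := by
  have hB := fun {m x y z w} =>
    windowBad_top_iff h he.1 he.2.1 he.2.2.1 he.2.2.2 (m := m) (x := x) (y := y) (z := z) (w := w)
  have hcons : ∀ x t, (∀ y z w c, t = y :: z :: w :: c →
      ¬ (x < c.length + 3 ∧ y < c.length + 2 ∧ z < c.length + 1 ∧ w < c.length)) →
      avoidWeight (windowBad a b c d e) (x :: t) = avoidWeight (windowBad a b c d e) t := by
    intro x t ht
    rcases t with _ | ⟨y, _ | ⟨z, _ | ⟨w, c⟩⟩⟩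
    · rfl
    · rfl
    · rfl
    · rw [avoidWeight, if_neg]
      rw [hB]
      exact fun h' => ht y z w c rfl h'.2
  induction l with
  | nil =>
    intro _
    rw [List.nil_append, hcons]
    · simp [typeWeight, avoidWeight]
    · rintro y z w c rfl
      simp
  | cons x l ih =>
    intro hl
    have hl2 : IsCode (l.length + r.length) l := by
      have := hl.2
      rwa [List.length_cons, Nat.add_right_comm, Nat.add_sub_cancel] at this
    have ih := ih hl2
    have hx : x < l.length + 1 + r.length := hl.1
    rcases l with _ | ⟨y, _ | ⟨z, _ | ⟨w, l⟩⟩⟩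
    -- With at most three entries left in the prefix, the first window, if there is one, contains
    -- the maximal entry.
    · rw [List.cons_append, hcons, ih]
      · rfl
      · intro y z w c hc
        have := congrArg List.length hc
        simp at this hc
        omega
    · rw [List.cons_append, hcons, ih]
      · rfl
      · intro y z w c hc
        have := congrArg List.length hc
        simp at this hc
        omega
    · rw [List.cons_append, hcons, ih]
      · rfl
      · intro y z w c hc
        have := congrArg List.length hc
        simp at this hc
        omega
    · obtain ⟨hy, hz, hw, -⟩ := hl2
      simp only [List.length_cons] at hx hy hz hw
      simp only [List.cons_append] at ih ⊢
      rw [avoidWeight, ih]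
      simp only [typeWeight]
      rw [avoidWeight_cons₄ _ x y z w l]
      have hlen : (l ++ r.length :: r).length = l.length + r.length + 1 := by simp; omega
      have hiff : windowBad a b c d e ((l ++ r.length :: r).length + 4) x y z w = true ↔
          windowType a b c d x y z w = true := by
        rw [hB, hlen]
        exact and_iff_left (by omega)
      by_cases hT : windowType a b c d x y z w = true
      · rw [if_pos (hiff.2 hT), if_pos hT, zero_mul]
      · rw [if_neg (hiff.not.2 hT), if_neg hT]

/-- Sum over the number `j` of letters before the maximum. The first factor counts injective
sequences that avoid a consecutive pattern and does not involve `e`. -/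
theorem avoidCount_top_succ {a b c d e : ℕ} (h : [a, b, c, d].Nodup)
    (he : a < e ∧ b < e ∧ c < e ∧ d < e) (n : ℕ) :
    avoidCount (windowBad a b c d e) (n + 1) = ∑ j ∈ Finset.range (n + 1),
      codeSum n j (typeWeight (windowType a b c d)) * avoidCount (windowBad a b c d e) (n - j) := by
  rw [avoidCount, codeSum_split_first_max]
  refine Finset.sum_congr rfl fun j hj => ?_
  rw [Finset.mem_range] at hj
  rw [mul_comm, ← codeSum_mul]
  refine codeSum_congr fun l hl hv => ?_
  rw [mul_comm, avoidCount, ← codeSum_mul]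
  refine codeSum_congr fun r hr _ => ?_
  rw [← hr]
  refine avoidWeight_append_max h he l r ?_
  rwa [hl, hr, Nat.add_sub_of_le (by omega)]

theorem ofFn_rev {α : Type*} {j : ℕ} (f : Fin j → α) :
    List.ofFn (fun i => f i.rev) = (List.ofFn f).reverse := by
  refine List.ext_getElem (by simp) fun i h₁ h₂ => ?_
  simp only [List.getElem_ofFn, List.getElem_reverse, List.length_ofFn]
  congr 1
  simp [Fin.ext_iff, Fin.val_rev]
  omega

/-- Reversal is not visible on codes, so the proof passes to injective sequences, where reversing
positions reverses the consecutive pattern. -/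
theorem codeSum_typeWeight_reverse {a b c d : ℕ} (h : [a, b, c, d].Nodup) (N j : ℕ) :
    codeSum N j (typeWeight (windowType a b c d)) =
      codeSum N j (typeWeight (windowType d c b a)) := by
  classical
  have h' : [d, c, b, a].Nodup := by simpa using List.nodup_reverse.2 h
  simp only [funext (typeWeight_windowType h), funext (typeWeight_windowType h')]
  rw [codeSum_decode j N fun l => if ListContainsConsecutive a b c d l then 0 else 1,
    codeSum_decode j N fun l => if ListContainsConsecutive d c b a l then 0 else 1,
    ← (Equiv.embeddingCongr Fin.revPerm (Equiv.refl (Fin N))).sum_comp]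
  refine Finset.sum_congr rfl fun f _ => ?_
  have : (List.ofFn fun i => ((Equiv.embeddingCongr Fin.revPerm (Equiv.refl (Fin N)) f) i : ℕ)) =
      (List.ofFn fun i => (f i : ℕ)).reverse := ofFn_rev fun i => (f i : ℕ)
  rw [this]
  simp only [listContainsConsecutive_reverse]

/-- The patterns `abcd-e` and `dcba-e` with largest letter `e` are Wilf-equivalent. -/
theorem avoidCount_top_reverse {a b c d e : ℕ} (h : [a, b, c, d].Nodup)
    (he : a < e ∧ b < e ∧ c < e ∧ d < e) (n : ℕ) :
    avoidCount (windowBad a b c d e) n = avoidCount (windowBad d c b a e) n := by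
  have h' : [d, c, b, a].Nodup := by simpa using List.nodup_reverse.2 h
  induction n using Nat.strong_induction_on with
  | _ n ih =>
    rcases n with _ | n
    · rfl
    · rw [avoidCount_top_succ h he, avoidCount_top_succ h' (by tauto)]
      refine Finset.sum_congr rfl fun j _ => ?_
      rw [codeSum_typeWeight_reverse h, ih _ (by omega)]

/-! ### The pattern `2143` with a condition on one of its two descents -/

/-- The number of avoiding codes of length `m + 2` that begin with `x, y`. -/
def pairCount (B : ℕ → ℕ → ℕ → ℕ → ℕ → Bool) (m x y : ℕ) : ℕ :=
  codeSum m m fun c => avoidWeight B (x :: y :: c)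

theorem firstCount_succ (B : ℕ → ℕ → ℕ → ℕ → ℕ → Bool) (m x : ℕ) :
    firstCount B (m + 1) x = ∑ y ∈ Finset.range (m + 1), pairCount B m x y := rfl

/-- The number of avoiding codes of length `m + 2` that begin with `z, w`, where `Q z w` and
`t ≤ w`. -/
def descentCount (B : ℕ → ℕ → ℕ → ℕ → ℕ → Bool) (Q : ℕ → ℕ → Prop) [DecidableRel Q] (m t : ℕ) : ℕ :=
  ∑ z ∈ Finset.range (m + 2), ∑ w ∈ Finset.range (m + 1),
    if Q z w ∧ t ≤ w then pairCount B m z w else 0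

/-- In the range of codes, `B` describes two descents `x, y` and `z, w`, subject to the conditions
`P` and `Q`, such that the values of the second one are above those of the first one. -/
structure TwoDescents (B : ℕ → ℕ → ℕ → ℕ → ℕ → Bool) (P Q : ℕ → ℕ → Prop) : Prop where
  iff : ∀ m x y z w, x < m + 4 → y < m + 3 → z < m + 2 → w < m + 1 →
    (B (m + 4) x y z w = true ↔ P x y ∧ x ≤ w + 1 ∧ Q z w)
  lt : ∀ m x y z w, B m x y z w = true → y < x
  lt_left : ∀ x y, P x y → y < x
  lt_right : ∀ x y, Q x y → y < x

namespace TwoDescents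

variable {B : ℕ → ℕ → ℕ → ℕ → ℕ → Bool} {P Q : ℕ → ℕ → Prop} [DecidableRel P] [DecidableRel Q]

/-- Put `x` in front of an avoiding code that begins with `y`. If `x, y, z, w` is bad, then `y < z`,
so no bad window begins at `y`, and what remains is an avoiding code that begins with the second
descent `z, w`. The truncation in `x - 1` is harmless, since `P x y` forces `0 < x`. -/
theorem pairCount_add (h : TwoDescents B P Q) {m x y : ℕ} (hx : x < m + 4) (hy : y < m + 3) :
    pairCount B (m + 2) x y + (if P x y then descentCount B Q m (x - 1) else 0) =
      firstCount B (m + 2) y := by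
  have h1 : (if P x y then descentCount B Q m (x - 1) else 0) =
      ∑ z ∈ Finset.range (m + 2), ∑ w ∈ Finset.range (m + 1),
        if P x y ∧ x ≤ w + 1 ∧ Q z w then pairCount B m z w else 0 := by
    split_ifs with hP
    · have := h.lt_left _ _ hP
      refine Finset.sum_congr rfl fun z _ => Finset.sum_congr rfl fun w _ => ?_
      refine if_congr ?_ rfl rfl
      have : x - 1 ≤ w ↔ x ≤ w + 1 := by omega
      tauto
    · simp [hP]
  rw [h1, pairCount, firstCount]
  simp only [codeSum_succ, ← Finset.sum_add_distrib]
  refine Finset.sum_congr rfl fun z hz => Finset.sum_congr rfl fun w hw => ?_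
  rw [Finset.mem_range] at hz hw
  have hB := h.iff m x y z w hx hy hz hw
  by_cases hb : B (m + 4) x y z w = true
  · rw [if_pos (hB.1 hb), pairCount, ← codeSum_add]
    refine codeSum_congr fun c hc _ => ?_
    rw [avoidWeight, hc, if_pos hb, zero_add]
    rcases c with _ | ⟨t, c⟩
    · rfl
    · rw [avoidWeight_cons₄ B y z w t c, if_neg]
      intro hb'
      have h1 := h.lt _ _ _ _ _ hb'
      have h2 := hB.1 hb
      have h3 := h.lt_left _ _ h2.1
      have h4 := h.lt_right _ _ h2.2.2
      omega
  · rw [if_neg (hB.not.1 hb), add_zero]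
    refine codeSum_congr fun c hc _ => ?_
    rw [avoidWeight, hc, if_neg hb]

theorem firstCount_add (h : TwoDescents B P Q) {m x : ℕ} (hx : x < m + 4) :
    firstCount B (m + 3) x +
      ((Finset.range (m + 3)).filter (P x)).card * descentCount B Q m (x - 1) =
        avoidCount B (m + 3) := by
  rw [firstCount_succ, Finset.card_filter, Finset.sum_mul, avoidCount_succ,
    ← Finset.sum_add_distrib]
  refine Finset.sum_congr rfl fun y hy => ?_
  rw [Finset.mem_range] at hy
  rw [← h.pairCount_add hx hy]
  simp

/-- A second descent may be the first descent of the next bad window. Summing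
`TwoDescents.pairCount_add` over the admissible descents `z, w` therefore closes the recursion. -/
theorem descentCount_add (h : TwoDescents B P Q) (m t : ℕ) :
    descentCount B Q (m + 2) t +
      ∑ z ∈ Finset.range (m + 4), ∑ w ∈ Finset.range (m + 3),
        (if (Q z w ∧ P z w) ∧ t ≤ w then descentCount B Q m (z - 1) else 0) =
      ∑ w ∈ Finset.range (m + 3), if t ≤ w then
        ((Finset.range (m + 4)).filter fun z => Q z w).card * firstCount B (m + 2) w else 0 := by
  rw [descentCount, ← Finset.sum_add_distrib]
  simp only [← Finset.sum_add_distrib]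
  rw [Finset.sum_comm]
  refine Finset.sum_congr rfl fun w hw => ?_
  rw [Finset.card_filter, Finset.sum_mul]
  rw [Finset.mem_range] at hw
  split_ifs with ht
  · refine Finset.sum_congr rfl fun z hz => ?_
    rw [Finset.mem_range] at hz
    rw [← h.pairCount_add hz hw]
    by_cases hQ : Q z w <;> by_cases hP : P z w <;> simp [hQ, hP, ht]
  · simp [ht]

end TwoDescents

theorem descentCount_of_lt {B : ℕ → ℕ → ℕ → ℕ → ℕ → Bool} {Q : ℕ → ℕ → Prop} [DecidableRel Q]
    {m t : ℕ} (h : m < t) : descentCount B Q m t = 0 := by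
  refine Finset.sum_eq_zero fun z _ => Finset.sum_eq_zero fun w hw => if_neg ?_
  rw [Finset.mem_range] at hw
  omega

theorem pairCount_of_lt {B : ℕ → ℕ → ℕ → ℕ → ℕ → Bool} {m : ℕ} (hm : m < 2) (x y : ℕ) :
    pairCount B m x y = codeSum m m fun _ => 1 :=
  codeSum_congr fun c hc _ => avoidWeight_of_length_lt (by simp; omega)

theorem firstCount_of_lt {B : ℕ → ℕ → ℕ → ℕ → ℕ → Bool} {m : ℕ} (hm : m < 3) (x : ℕ) :
    firstCount B m x = codeSum m m fun _ => 1 :=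
  codeSum_congr fun c hc _ => avoidWeight_of_length_lt (by simp; omega)

theorem sum_range_succ_shift (n : ℕ) (f g : ℕ → ℕ) (h0 : f 0 = 0) (hn : g n = 0)
    (h : ∀ i < n, f (i + 1) = g i) :
    ∑ i ∈ Finset.range (n + 1), f i = ∑ i ∈ Finset.range (n + 1), g i := by
  rw [Finset.sum_range_succ', Finset.sum_range_succ, h0, hn]
  congr 1
  exact Finset.sum_congr rfl fun i hi => h i (Finset.mem_range.1 hi)

/-- Requiring the first or the second descent to be wide yields equinumerous avoiding codes. -/
theorem TwoDescents.avoidCount_eq {B B' : ℕ → ℕ → ℕ → ℕ → ℕ → Bool}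
    (h : TwoDescents B (fun x y => y + 1 < x) (fun x y => y < x))
    (h' : TwoDescents B' (fun x y => y < x) (fun x y => y + 1 < x)) (n : ℕ) :
    avoidCount B n = avoidCount B' n := by
  have card_lt : ∀ n x, x ≤ n → ((Finset.range n).filter fun y => y < x).card = x := by
    intro n x hx
    have : (Finset.range n).filter (fun y => y < x) = Finset.range x := by
      ext y; simp; omega
    rw [this, Finset.card_range]
  have card_succ_lt : ∀ n x, x ≤ n → ((Finset.range n).filter fun y => y + 1 < x).card = x - 1 := by
    intro n x hx
    have : (Finset.range n).filter (fun y => y + 1 < x) = Finset.range (x - 1) := by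
      ext y; simp; omega
    rw [this, Finset.card_range]
  have card_gt : ∀ n w, ((Finset.range n).filter fun z => w < z).card = n - 1 - w := by
    intro n w
    have : (Finset.range n).filter (fun z => w < z) = Finset.Ico (w + 1) n := by
      ext y; simp; omega
    rw [this, Nat.card_Ico]; omega
  let f := firstCount B
  let f' := firstCount B'
  let H := descentCount B fun x y => y < x
  let H' := descentCount B' fun x y => y + 1 < x
  have hf : ∀ m x, x < m + 4 → f (m + 3) x + (x - 1) * H m (x - 1) = avoidCount B (m + 3) := by
    intro m x hx
    have := h.firstCount_add hx
    rwa [card_succ_lt _ _ (by omega)] at this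
  have hf' : ∀ m x, x < m + 4 → f' (m + 3) x + x * H' m (x - 1) = avoidCount B' (m + 3) := by
    intro m x hx
    have := h'.firstCount_add hx
    rwa [card_lt _ _ (by omega)] at this
  -- First entry `x + 1` for `B` corresponds to `x` for `B'`, since as many `y` satisfy `y + 1 < x +
  -- 1` as `y < x`. First entry `0` for `B` is matched with the largest first entry for `B'`.
  have key : ∀ m, avoidCount B m = avoidCount B' m ∧ (∀ x < m, f m (x + 1) = f' m x) ∧
      ∀ t, H m (t + 1) = H' m t := by
    intro m
    induction m using Nat.strong_induction_on with
    | _ m ih =>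
      have hA : avoidCount B m = avoidCount B' m := by
        rcases m with _ | m
        · rfl
        · rw [avoidCount_succ, avoidCount_succ, Finset.sum_range_succ', Finset.sum_range_succ]
          congr 1
          · refine Finset.sum_congr rfl fun x hx => (ih m (by omega)).2.1 x ?_
            simpa using hx
          · rcases Nat.lt_or_ge m 3 with hm | hm
            · rw [firstCount_of_lt hm, firstCount_of_lt hm]
            · obtain ⟨m, rfl⟩ := Nat.exists_eq_add_of_le' hm
              -- Entry `0` begins no descent, and the largest entry leaves no room for a later
              -- descent above it. Both remaining terms are thus the avoidance counts of length `m +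
              -- 3`.
              have e1 := hf m 0 (by omega)
              have e2 := hf' m (m + 3) (by omega)
              have e3 : H' m (m + 3 - 1) = 0 := descentCount_of_lt (by omega)
              rw [e3, mul_zero, add_zero] at e2
              rw [Nat.zero_sub, zero_mul, add_zero] at e1
              exact e1.trans ((ih (m + 3) (by omega)).1.trans e2.symm)
      have hF : ∀ x < m, f m (x + 1) = f' m x := by
        intro x hx
        rcases Nat.lt_or_ge m 3 with hm | hm
        · exact (firstCount_of_lt hm _).trans (firstCount_of_lt hm _).symm
        · obtain ⟨m, rfl⟩ := Nat.exists_eq_add_of_le' hm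
          have e1 := hf m (x + 1) (by omega)
          have e2 := hf' m x (by omega)
          rw [Nat.add_sub_cancel] at e1
          rcases x with _ | x
          · rw [zero_mul] at e1 e2
            omega
          · rw [Nat.add_sub_cancel] at e2
            rw [(ih m (by omega)).2.2 x] at e1
            omega
      refine ⟨hA, hF, fun t => ?_⟩
      rcases Nat.lt_or_ge m 2 with hm | hm
      · simp only [H, H', descentCount, pairCount_of_lt hm]
        interval_cases m <;> rcases t with _ | _ | t <;> simp [Finset.sum_range_succ]
      · obtain ⟨m, rfl⟩ := Nat.exists_eq_add_of_le' hm
        have e1 := h.descentCount_add m (t + 1)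
        have e2 := h'.descentCount_add m t
        have e3 : (∑ w ∈ Finset.range (m + 3), if t + 1 ≤ w then
            ((Finset.range (m + 4)).filter fun z => w < z).card * firstCount B (m + 2) w else 0) =
            ∑ w ∈ Finset.range (m + 3), if t ≤ w then
            ((Finset.range (m + 4)).filter fun z => w + 1 < z).card * firstCount B' (m + 2) w
              else 0 := by
          refine sum_range_succ_shift (m + 2) _ _ (by simp) ?_ fun w hw => ?_
          · have : ((Finset.range (m + 4)).filter fun z => m + 2 + 1 < z).card = 0 := by
              rw [card_gt]; omega
            rw [this]; simp
          · rw [card_gt]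
            simp only [Nat.add_le_add_iff_right]
            have := hF w hw
            simp only [f, f'] at this
            rw [this]
        -- For both families the conjunction of the two conditions says that the descent is wide,
        -- which is invariant under lowering `z` and `w` together. The boundary terms vanish.
        have e4 : (∑ z ∈ Finset.range (m + 4), ∑ w ∈ Finset.range (m + 3),
            if (w < z ∧ w + 1 < z) ∧ t + 1 ≤ w then H m (z - 1) else 0) =
            ∑ z ∈ Finset.range (m + 4), ∑ w ∈ Finset.range (m + 3),
            if (w + 1 < z ∧ w < z) ∧ t ≤ w then H' m (z - 1) else 0 := by
          refine sum_range_succ_shift (m + 3) _ _ (by simp) ?_ fun z hz => ?_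
          · have : H' m (m + 3 - 1) = 0 := descentCount_of_lt (by omega)
            rw [this]; simp
          · refine sum_range_succ_shift (m + 2) _ _ (by simp) ?_ fun w hw => ?_
            · rw [if_neg]; omega
            · have : (w + 1 < z + 1 ∧ w + 1 + 1 < z + 1) ∧ t + 1 ≤ w + 1 ↔
                  (w + 1 < z ∧ w < z) ∧ t ≤ w := by omega
              rw [Nat.add_sub_cancel]
              simp only [this]
              split_ifs with hc
              · rw [← (ih m (by omega)).2.2 (z - 1)]
                congr 1; omega
              · rfl
        simp only [H, H'] at e4 ⊢
        omega
  exact (key n).1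

/-! ### Increasing patterns -/

/-- The number of avoiding codes of length `n` that are empty or begin with an entry below `x`. -/
def dropCount (B : ℕ → ℕ → ℕ → ℕ → ℕ → Bool) : ℕ → ℕ → ℕ
  | 0, _ => 1
  | n + 1, x => ∑ y ∈ Finset.range (n + 1), if y < x then firstCount B n y else 0

/-- Windows that satisfy `B` are weakly increasing. -/
def IsIncreasing (B : ℕ → ℕ → ℕ → ℕ → ℕ → Bool) : Prop :=
  ∀ m x y z w, B m x y z w = true → x ≤ y ∧ y ≤ z ∧ z ≤ w

namespace IsIncreasing

variable {B : ℕ → ℕ → ℕ → ℕ → ℕ → Bool}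

/-- No bad window crosses a drop of the code, so the entries before a drop can be forgotten. The
next two lemmas do the same for a later drop. -/
theorem avoidWeight_cons (h : IsIncreasing B) {x y : ℕ} (hxy : y < x) (c : List ℕ) :
    avoidWeight B (x :: y :: c) = avoidWeight B (y :: c) := by
  rcases c with _ | ⟨z, _ | ⟨w, c⟩⟩
  · rfl
  · rfl
  · rw [avoidWeight_cons₄, if_neg]
    intro hB
    have := h _ _ _ _ _ hB
    omega

theorem avoidWeight_cons_cons (h : IsIncreasing B) {x y z : ℕ} (hyz : z < y) (c : List ℕ) :
    avoidWeight B (x :: y :: z :: c) = avoidWeight B (z :: c) := by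
  rw [← h.avoidWeight_cons hyz]
  rcases c with _ | ⟨w, c⟩
  · rfl
  · rw [avoidWeight_cons₄, if_neg]
    intro hB
    have := h _ _ _ _ _ hB
    omega

theorem avoidWeight_cons_cons_cons (h : IsIncreasing B) {x y z w : ℕ} (hzw : w < z) (c : List ℕ) :
    avoidWeight B (x :: y :: z :: w :: c) = avoidWeight B (w :: c) := by
  rw [← h.avoidWeight_cons_cons hzw (x := y), avoidWeight_cons₄, if_neg]
  intro hB
  have := h _ _ _ _ _ hB
  omega

end IsIncreasing

/-- Splitting a sum over first entries into those below, equal to, and above `y`. -/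
theorem codeSum_succ_split {n y : ℕ} (φ : List ℕ → ℕ) {a g : ℕ → ℕ} {b : ℕ}
    (ha : ∀ z < n + 1, z < y → codeSum n n (fun c => φ (z :: c)) = a z)
    (hb : y < n + 1 → codeSum n n (fun c => φ (y :: c)) = b)
    (hg : ∀ z < n + 1, y < z → codeSum n n (fun c => φ (z :: c)) = g z) :
    codeSum (n + 1) (n + 1) φ = (∑ z ∈ Finset.range (n + 1), if z < y then a z else 0) +
      (if y < n + 1 then b else 0) + ∑ z ∈ Finset.range (n + 1), if y < z then g z else 0 := by
  have h1 : (if y < n + 1 then b else 0) = ∑ z ∈ Finset.range (n + 1), if y = z then b else 0 := by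
    simp
  rw [codeSum_succ, h1, ← Finset.sum_add_distrib, ← Finset.sum_add_distrib]
  refine Finset.sum_congr rfl fun z hz => ?_
  rw [Finset.mem_range] at hz
  rcases lt_trichotomy z y with h | h | h
  · rw [ha z hz h, if_pos h, if_neg (by omega), if_neg (by omega)]; rfl
  · subst h
    rw [hb hz]; simp
  · rw [hg z hz h, if_pos h, if_neg (by omega), if_neg (by omega)]; omega

/-- The numbers of avoiding codes by their first entry are given by the numbers of increasing runs
with two free steps. -/
def RunFormula (B : ℕ → ℕ → ℕ → ℕ → ℕ → Bool) : Prop :=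
  ∀ m x, x ≤ m → firstCount B m x = dropCount B m x +
    (∑ y ∈ Finset.range m, if x ≤ y then dropCount B (m - 1) y else 0) +
    ∑ k ∈ Finset.range (m - 1), ∑ y ∈ Finset.range (k + 1), (y + 1 - x) * dropCount B k y

/-- The formula is a recursion in which `B` no longer occurs explicitly: each `dropCount` on its
right-hand side is made of counts by first entry for shorter codes. -/
theorem RunFormula.avoidCount_eq {B B' : ℕ → ℕ → ℕ → ℕ → ℕ → Bool} (h : RunFormula B)
    (h' : RunFormula B') (n : ℕ) : avoidCount B n = avoidCount B' n := by
  have key : ∀ m, ∀ x ≤ m, firstCount B m x = firstCount B' m x := by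
    intro m
    induction m using Nat.strong_induction_on with
    | _ m ih =>
      have hd : ∀ k ≤ m, ∀ y, dropCount B k y = dropCount B' k y := by
        intro k hk y
        rcases k with _ | k
        · rfl
        · refine Finset.sum_congr rfl fun z hz => ?_
          rw [Finset.mem_range] at hz
          rw [ih k (by omega) z (by omega)]
      intro x hx
      rw [h m x hx, h' m x hx, hd m le_rfl]
      congr 1
      · congr 1
        exact Finset.sum_congr rfl fun y _ => by rw [hd _ (by omega)]
      · refine Finset.sum_congr rfl fun k hk => Finset.sum_congr rfl fun y _ => ?_
        rw [Finset.mem_range] at hk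
        rw [hd _ (by omega)]
  exact avoidCount_congr fun m _ x hx => key m x hx

theorem sum_range_ite_le (n x z : ℕ) (hz : z < n) (a : ℕ) :
    (∑ y ∈ Finset.range n, if x ≤ y ∧ y ≤ z then a else 0) = (z + 1 - x) * a := by
  rw [← Finset.sum_filter, Finset.sum_const, smul_eq_mul]
  congr 1
  have : (Finset.range n).filter (fun y => x ≤ y ∧ y ≤ z) = Finset.Ico x (z + 1) := by
    ext y; simp; omega
  rw [this, Nat.card_Ico]

theorem sum_range_ite_le_eq (n x : ℕ) (f : ℕ → ℕ) :
    (∑ y ∈ Finset.range n, if x ≤ y then f y else 0) =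
      (if x < n then f x else 0) + ∑ y ∈ Finset.range n, if x < y then f y else 0 := by
  have : (if x < n then f x else 0) = ∑ y ∈ Finset.range n, if x = y then f x else 0 := by simp
  rw [this, ← Finset.sum_add_distrib]
  refine Finset.sum_congr rfl fun y _ => ?_
  rcases lt_trichotomy x y with h | h | h
  · rw [if_pos h.le, if_neg (by omega), if_pos h, zero_add]
  · subst h; simp
  · rw [if_neg (by omega), if_neg (by omega), if_neg (by omega)]

/-- After the wide step from `x` to `y`, the run may contain at most one more entry `z`, for two
further weak ascents would complete a bad window. -/
theorem codeSum_wideFirstStep {B : ℕ → ℕ → ℕ → ℕ → ℕ → Bool}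
    (hB : ∀ m x y z w, w < m + 1 → (B (m + 4) x y z w = true ↔ x < y ∧ y ≤ z ∧ z ≤ w))
    (hi : IsIncreasing B) {m x y : ℕ} (hxy : x < y) :
    codeSum m m (fun c => avoidWeight B (x :: y :: c)) = dropCount B m y +
      ∑ z ∈ Finset.range m, if y ≤ z then dropCount B (m - 1) z else 0 := by
  rcases m with _ | m
  · rfl
  · have hz : ∀ z, y ≤ z → codeSum m m (fun c => avoidWeight B (x :: y :: z :: c)) =
        dropCount B m z := by
      intro z hyz
      rcases m with _ | m
      · rfl
      · rw [codeSum_succ]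
        refine Finset.sum_congr rfl fun w hw => ?_
        rw [Finset.mem_range] at hw
        split_ifs with hwz
        · exact codeSum_congr fun c _ _ => hi.avoidWeight_cons_cons_cons hwz c
        · rw [codeSum_congr (ψ := fun _ => 0), codeSum_zero]
          intro c hc _
          rw [avoidWeight_cons₄, hc, if_pos ((hB _ _ _ _ _ hw).2 (by omega))]
    rw [codeSum_succ, dropCount, Nat.add_sub_cancel, ← Finset.sum_add_distrib]
    refine Finset.sum_congr rfl fun z _ => ?_
    by_cases h : z < y
    · rw [if_pos h, if_neg (by omega), add_zero]
      exact codeSum_congr fun c _ _ => hi.avoidWeight_cons_cons h c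
    · rw [if_neg h, if_pos (by omega), zero_add, hz z (by omega)]

/-- An admissible run of length at least three has the form `x, …, x, y, z` with `x ≤ y ≤ z`. Its
last entry leaves `z + 1 - x` choices for `y`. The induction removes one copy of `x` at a time. -/
theorem runFormula_wideFirstStep {B : ℕ → ℕ → ℕ → ℕ → ℕ → Bool}
    (hB : ∀ m x y z w, w < m + 1 → (B (m + 4) x y z w = true ↔ x < y ∧ y ≤ z ∧ z ≤ w))
    (hi : IsIncreasing B)
    (hmono : ∀ m x y z w, B m x y z w = true → x < y) :
    RunFormula B := by
  intro m
  induction m with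
  | zero => intro x _; rfl
  | succ m ih =>
    intro x hx
    rw [firstCount, codeSum_succ_split (y := x) _ (a := firstCount B m) (b := firstCount B m x)
      (g := fun y => dropCount B m y +
        ∑ z ∈ Finset.range m, if y ≤ z then dropCount B (m - 1) z else 0)
      (fun z _ hz => codeSum_congr fun c _ _ => hi.avoidWeight_cons hz c)
      (fun _ => codeSum_congr fun c _ _ => ?_)
      (fun z _ hz => codeSum_wideFirstStep hB hi hz)]
    · rw [dropCount, add_assoc, add_assoc]
      congr 1
      have hsplit : (∑ y ∈ Finset.range (m + 1), if x < y then dropCount B m y +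
          (∑ z ∈ Finset.range m, if y ≤ z then dropCount B (m - 1) z else 0) else 0) =
          (∑ y ∈ Finset.range (m + 1), if x < y then dropCount B m y else 0) +
          ∑ z ∈ Finset.range m, (z - x) * dropCount B (m - 1) z := by
        have : ∀ z ∈ Finset.range m, (z - x) * dropCount B (m - 1) z =
            ∑ y ∈ Finset.range (m + 1), if x < y then
              (if y ≤ z then dropCount B (m - 1) z else 0) else 0 := by
          intro z hz
          rw [Finset.mem_range] at hz
          rw [← Nat.add_sub_add_right z 1 x, ← sum_range_ite_le (m + 1) (x + 1) z (by omega)]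
          refine Finset.sum_congr rfl fun y _ => ?_
          rw [← ite_and]
          exact if_congr (by omega) rfl rfl
        rw [Finset.sum_congr rfl this, Finset.sum_comm, ← Finset.sum_add_distrib]
        refine Finset.sum_congr rfl fun y _ => ?_
        split_ifs <;> simp
      rw [hsplit, Nat.add_sub_cancel]
      rw [sum_range_ite_le_eq]
      by_cases hxm : x < m + 1
      · rw [if_pos hxm, if_pos hxm, ih x (by omega)]
        rcases m with _ | m
        · simp
        · rw [Nat.add_sub_cancel, Finset.sum_range_succ (fun k => ∑ y ∈ Finset.range (k + 1),
            (y + 1 - x) * dropCount B k y) m]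
          -- For `x ≤ y` the weight `y + 1 - x` splits as `1 + (y - x)`: the middle entry equals `x`
          -- or lies above it.
          have : ∑ y ∈ Finset.range (m + 1), (y + 1 - x) * dropCount B m y =
              (∑ y ∈ Finset.range (m + 1), if x ≤ y then dropCount B m y else 0) +
              ∑ y ∈ Finset.range (m + 1), (y - x) * dropCount B m y := by
            rw [← Finset.sum_add_distrib]
            refine Finset.sum_congr rfl fun y _ => ?_
            split_ifs with h
            · rw [Nat.sub_add_comm h]; ring
            · rw [Nat.sub_eq_zero_of_le (by omega), Nat.sub_eq_zero_of_le (by omega)]; simp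
          rw [this]
          ring
      -- Here `x = m + 1` is the largest possible entry, and nothing after it can reach `x`.
      · rw [if_neg hxm, if_neg hxm]
        have h1 : ∑ z ∈ Finset.range m, (z - x) * dropCount B (m - 1) z = 0 :=
          Finset.sum_eq_zero fun z hz => by
            rw [Finset.mem_range] at hz
            rw [Nat.sub_eq_zero_of_le (by omega), zero_mul]
        have h2 : ∑ k ∈ Finset.range m, ∑ y ∈ Finset.range (k + 1),
            (y + 1 - x) * dropCount B k y = 0 :=
          Finset.sum_eq_zero fun k hk => Finset.sum_eq_zero fun y hy => by
            rw [Finset.mem_range] at hk hy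
            rw [Nat.sub_eq_zero_of_le (by omega), zero_mul]
        rw [h1, h2]
        omega
    · rcases c with _ | ⟨z, _ | ⟨w, c⟩⟩
      · rfl
      · rfl
      · rw [avoidWeight_cons₄, if_neg]
        intro h
        exact lt_irrefl _ (hmono _ _ _ _ _ h)

/-- When the free middle entry is the second one, the count for given `x ≤ y` does not depend on
`x`. Summing over `y` between `x` and the end `z` of the run produces the weight `z + 1 - x`. -/
theorem runFormula_of_codeSum_cons_cons {B : ℕ → ℕ → ℕ → ℕ → ℕ → Bool} (hi : IsIncreasing B)
    (h : ∀ m x y, x ≤ y → y ≤ m → codeSum m m (fun c => avoidWeight B (x :: y :: c)) =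
      dropCount B m y + ∑ k ∈ Finset.range m, ∑ z ∈ Finset.range (k + 1),
        if y ≤ z then dropCount B k z else 0) : RunFormula B := by
  intro m x hx
  rcases m with _ | m
  · rfl
  · have h1 : ∑ k ∈ Finset.range m, ∑ z ∈ Finset.range (k + 1), (z + 1 - x) * dropCount B k z =
        ∑ y ∈ Finset.range (m + 1), ∑ k ∈ Finset.range m, ∑ z ∈ Finset.range (k + 1),
          if x ≤ y ∧ y ≤ z then dropCount B k z else 0 := by
      rw [Finset.sum_comm]
      refine Finset.sum_congr rfl fun k hk => ?_
      rw [Finset.sum_comm]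
      refine Finset.sum_congr rfl fun z hz => ?_
      rw [Finset.mem_range] at hk hz
      rw [sum_range_ite_le _ _ _ (by omega)]
    rw [Nat.add_sub_cancel, h1, firstCount, codeSum_succ, dropCount, ← Finset.sum_add_distrib,
      ← Finset.sum_add_distrib]
    refine Finset.sum_congr rfl fun y hy => ?_
    rw [Finset.mem_range] at hy
    by_cases hxy : x ≤ y
    · simp only [hxy, true_and, if_true]
      rw [if_neg (by omega), zero_add, h m x y hxy (by omega)]
    · simp only [hxy, false_and, if_false, Finset.sum_const_zero, add_zero]
      rw [if_pos (by omega)]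
      exact codeSum_congr fun c _ _ => hi.avoidWeight_cons (by omega) c

/-- Here the admissible runs are `x, y, …, y, z`: after the second entry the code repeats `y`,
drops, or makes one wide step, after which it must drop or end. -/
theorem runFormula_wideSecondStep {B : ℕ → ℕ → ℕ → ℕ → ℕ → Bool}
    (hB : ∀ m x y z w, w < m + 1 → (B (m + 4) x y z w = true ↔ x ≤ y ∧ y < z ∧ z ≤ w))
    (hi : IsIncreasing B) (hmono : ∀ m x y z w, B m x y z w = true → y < z) : RunFormula B := by
  refine runFormula_of_codeSum_cons_cons hi fun m => ?_
  induction m with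
  | zero => intro x y _ _; rfl
  | succ m ih =>
    intro x y hxy hy
    rw [codeSum_succ_split (y := y) _ (a := firstCount B m) (b := dropCount B m y +
        ∑ k ∈ Finset.range m, ∑ z ∈ Finset.range (k + 1), if y ≤ z then dropCount B k z else 0)
      (g := dropCount B m) (fun z _ hz => codeSum_congr fun c _ _ => hi.avoidWeight_cons_cons hz c)
      (fun hy => ?_) (fun z _ hz => ?_)]
    · rw [dropCount, add_assoc]
      congr 1
      rw [Finset.sum_range_succ (fun k => ∑ z ∈ Finset.range (k + 1),
        if y ≤ z then dropCount B k z else 0) m]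
      rw [sum_range_ite_le_eq (m + 1)]
      by_cases h : y < m + 1
      · rw [if_pos h, if_pos h]; ring
      · rw [if_neg h, if_neg h]
        have : (∑ k ∈ Finset.range m, ∑ z ∈ Finset.range (k + 1),
            if y ≤ z then dropCount B k z else 0) = 0 :=
          Finset.sum_eq_zero fun k hk => Finset.sum_eq_zero fun z hz => if_neg (by
            rw [Finset.mem_range] at hk hz
            omega)
        rw [this, zero_add, zero_add]
    · rw [← ih y y le_rfl (by omega)]
      refine codeSum_congr fun c _ _ => ?_
      rcases c with _ | ⟨w, c⟩
      · rfl
      · rw [avoidWeight_cons₄, if_neg]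
        intro h
        exact lt_irrefl _ (hmono _ _ _ _ _ h)
    · rcases m with _ | m
      · rfl
      · rw [codeSum_succ]
        refine Finset.sum_congr rfl fun w hw => ?_
        rw [Finset.mem_range] at hw
        split_ifs with hwz
        · exact codeSum_congr fun c _ _ => hi.avoidWeight_cons_cons_cons hwz c
        · rw [codeSum_congr (ψ := fun _ => 0), codeSum_zero]
          intro c hc _
          rw [avoidWeight_cons₄, hc, if_pos ((hB _ _ _ _ _ hw).2 (by omega))]

/-- After three weakly increasing entries the last one can only be repeated until the code drops or
ends. The index `k` is the length left after the last copy of `z`, which requires `z ≤ k`. -/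
theorem codeSum_wideThirdStep {B : ℕ → ℕ → ℕ → ℕ → ℕ → Bool}
    (hB : ∀ m x y z w, w < m + 1 → (B (m + 4) x y z w = true ↔ x ≤ y ∧ y ≤ z ∧ z < w))
    (hi : IsIncreasing B) (hmono : ∀ m x y z w, B m x y z w = true → z < w) (m : ℕ) :
    ∀ x y z, x ≤ y → y ≤ z → z ≤ m → codeSum m m (fun c => avoidWeight B (x :: y :: z :: c)) =
      ∑ k ∈ Finset.range (m + 1), if z ≤ k then dropCount B k z else 0 := by
  induction m with
  | zero =>
    intro x y z _ _ hz
    obtain rfl : z = 0 := by omega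
    rfl
  | succ m ih =>
    intro x y z hxy hyz hz
    rw [codeSum_succ_split (y := z) _ (a := firstCount B m)
      (b := ∑ k ∈ Finset.range (m + 1), if z ≤ k then dropCount B k z else 0)
      (g := fun _ => 0)
      (fun w _ hw => codeSum_congr fun c _ _ => hi.avoidWeight_cons_cons_cons hw c)
      (fun hz => ?_) (fun w hw hzw => ?_)]
    · rw [Finset.sum_range_succ _ (m + 1), if_pos hz, dropCount]
      simp only [ite_self, Finset.sum_const_zero, add_zero]
      rw [add_comm]
      congr 1
      by_cases h : z < m + 1
      · rw [if_pos h]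
      · rw [if_neg h]
        refine (Finset.sum_eq_zero fun k hk => if_neg ?_).symm
        rw [Finset.mem_range] at hk
        omega
    · rw [← ih y z z hyz le_rfl (by omega)]
      refine codeSum_congr fun c _ _ => ?_
      rw [avoidWeight_cons₄, if_neg]
      intro h
      exact lt_irrefl _ (hmono _ _ _ _ _ h)
    · rw [codeSum_congr (ψ := fun _ => 0), codeSum_zero]
      intro c hc _
      rw [avoidWeight_cons₄, hc, if_pos ((hB _ _ _ _ _ hw).2 (by omega))]

theorem runFormula_wideThirdStep {B : ℕ → ℕ → ℕ → ℕ → ℕ → Bool}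
    (hB : ∀ m x y z w, w < m + 1 → (B (m + 4) x y z w = true ↔ x ≤ y ∧ y ≤ z ∧ z < w))
    (hi : IsIncreasing B) (hmono : ∀ m x y z w, B m x y z w = true → z < w) : RunFormula B := by
  refine runFormula_of_codeSum_cons_cons hi fun m x y hxy hy => ?_
  rcases m with _ | m
  · rfl
  · have h1 : (∑ k ∈ Finset.range (m + 1), ∑ z ∈ Finset.range (k + 1),
        if y ≤ z then dropCount B k z else 0) = ∑ z ∈ Finset.range (m + 1), if y ≤ z then
          (∑ k ∈ Finset.range (m + 1), if z ≤ k then dropCount B k z else 0) else 0 := by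
      have : ∀ k ∈ Finset.range (m + 1), (∑ z ∈ Finset.range (k + 1),
          if y ≤ z then dropCount B k z else 0) = ∑ z ∈ Finset.range (m + 1),
            if y ≤ z then (if z ≤ k then dropCount B k z else 0) else 0 := by
        intro k hk
        rw [Finset.mem_range] at hk
        have hr : Finset.range (k + 1) = (Finset.range (m + 1)).filter fun z => z ≤ k := by
          ext z; simp; omega
        rw [hr, Finset.sum_filter]
        refine Finset.sum_congr rfl fun z _ => ?_
        split_ifs <;> rfl
      rw [Finset.sum_congr rfl this, Finset.sum_comm]
      refine Finset.sum_congr rfl fun z _ => ?_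
      split_ifs <;> simp
    rw [h1, codeSum_succ, dropCount, ← Finset.sum_add_distrib]
    refine Finset.sum_congr rfl fun z hz => ?_
    rw [Finset.mem_range] at hz
    by_cases h : z < y
    · rw [if_pos h, if_neg (by omega), add_zero]
      exact codeSum_congr fun c _ _ => hi.avoidWeight_cons_cons h c
    · rw [if_neg h, if_pos (by omega), zero_add,
        codeSum_wideThirdStep hB hi hmono m x y z hxy (by omega) (by omega)]

/-! ### The individual patterns -/

theorem ltBit_eq (a b : ℕ) : ltBit a b = if a < b then 1 else 0 := by
  simp [ltBit, Bool.cond_eq_ite]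

theorem sameOrder_eq_true_iff {a a' v v' : ℕ} : sameOrder a a' v v' = true ↔
    if a < a' then v < v' else if a' < a then v' < v else v = v' := by
  rw [sameOrder_iff]
  split_ifs <;> omega

theorem windowBad_eq_true_iff {a b c d e m x y z w : ℕ} :
    windowBad a b c d e m x y z w = true ↔ windowType a b c d x y z w = true ∧ ∃ v < m,
      sameOrderLast a b c d e x (y + ltBit a b) (z + (ltBit a c + ltBit b c))
        (w + (ltBit a d + ltBit b d + ltBit c d)) v = true := by
  simp [windowBad]

/-- Overlaps are already excluded by the consecutive type `abcd`, whatever the last letter is. -/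
theorem nonOverlapping_windowBad {a b c d e : ℕ}
    (h : ∀ x y z w t s, windowType a b c d x y z w = true →
      ¬ windowType a b c d y z w t = true ∧ ¬ windowType a b c d z w t s = true) :
    NonOverlapping (windowBad a b c d e) := by
  intro m m' x y z w t s hB
  have := h x y z w t s (windowBad_eq_true_iff.1 hB).1
  simp only [← Bool.not_eq_true]
  exact ⟨fun h => this.1 (windowBad_eq_true_iff.1 h).1,
    fun h => this.2 (windowBad_eq_true_iff.1 h).1⟩

/-- The condition `B` on windows is given by `P` in the range of codes. -/
def IsWindowCondition (B : ℕ → ℕ → ℕ → ℕ → ℕ → Bool) (P : ℕ → ℕ → ℕ → ℕ → ℕ → Prop) : Prop :=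
  ∀ m x y z w, x < m + 4 → y < m + 3 → z < m + 2 → w < m + 1 →
    (B (m + 4) x y z w = true ↔ P m x y z w)

theorem avoidCount_eq_of_bij {B B' : ℕ → ℕ → ℕ → ℕ → ℕ → Bool} {P P' : ℕ → ℕ → ℕ → ℕ → ℕ → Prop}
    (h : NonOverlapping B) (h' : NonOverlapping B')
    (hP : IsWindowCondition B P) (hP' : IsWindowCondition B' P')
    (i j : ℕ × ℕ → ℕ × ℕ)
    (hi : ∀ m x y z w, x < m + 4 → y < m + 3 → z < m + 2 → w < m + 1 → P m x y z w →
      (i (y, z)).1 < m + 3 ∧ (i (y, z)).2 < m + 2 ∧ P' m x (i (y, z)).1 (i (y, z)).2 w ∧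
        j (i (y, z)) = (y, z))
    (hj : ∀ m x y z w, x < m + 4 → y < m + 3 → z < m + 2 → w < m + 1 → P' m x y z w →
      (j (y, z)).1 < m + 3 ∧ (j (y, z)).2 < m + 2 ∧ P m x (j (y, z)).1 (j (y, z)).2 w ∧
        i (j (y, z)) = (y, z)) (n : ℕ) :
    avoidCount B n = avoidCount B' n := by
  refine avoidCount_eq_of_nonOverlapping h h' (fun m x w hx hw => ?_) n
  refine Finset.card_nbij' i j ?_ ?_ ?_ ?_
  · rintro ⟨y, z⟩ hyz
    simp only [Finset.coe_filter, Finset.mem_product, Finset.mem_range, Set.mem_ofPred_eq] at hyz ⊢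
    obtain ⟨⟨hy, hz⟩, hB⟩ := hyz
    obtain ⟨h1, h2, h3, -⟩ := hi m x y z w hx hy hz hw ((hP m x y z w hx hy hz hw).1 hB)
    exact ⟨⟨h1, h2⟩, (hP' _ _ _ _ _ hx h1 h2 hw).2 h3⟩
  · rintro ⟨y, z⟩ hyz
    simp only [Finset.coe_filter, Finset.mem_product, Finset.mem_range, Set.mem_ofPred_eq] at hyz ⊢
    obtain ⟨⟨hy, hz⟩, hB⟩ := hyz
    obtain ⟨h1, h2, h3, -⟩ := hj m x y z w hx hy hz hw ((hP' m x y z w hx hy hz hw).1 hB)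
    exact ⟨⟨h1, h2⟩, (hP _ _ _ _ _ hx h1 h2 hw).2 h3⟩
  · rintro ⟨y, z⟩ hyz
    simp only [Finset.coe_filter, Finset.mem_product, Finset.mem_range, Set.mem_ofPred_eq] at hyz
    obtain ⟨⟨hy, hz⟩, hB⟩ := hyz
    exact (hi m x y z w hx hy hz hw ((hP m x y z w hx hy hz hw).1 hB)).2.2.2
  · rintro ⟨y, z⟩ hyz
    simp only [Finset.coe_filter, Finset.mem_product, Finset.mem_range, Set.mem_ofPred_eq] at hyz
    obtain ⟨⟨hy, hz⟩, hB⟩ := hyz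
    exact (hj m x y z w hx hy hz hw ((hP' m x y z w hx hy hz hw).1 hB)).2.2.2

/-- In the applications the second letter is one below the last letter. Exchanging these two values
moves the strict gap to the other side of the second letter, which raises its code entry by one. -/
theorem avoidCount_eq_of_succ_second {B B' : ℕ → ℕ → ℕ → ℕ → ℕ → Bool}
    {P P' : ℕ → ℕ → ℕ → ℕ → ℕ → Prop} (h : NonOverlapping B) (h' : NonOverlapping B')
    (hP : IsWindowCondition B P) (hP' : IsWindowCondition B' P')
    (hi : ∀ m x y z w, x < m + 4 → y < m + 3 → z < m + 2 → w < m + 1 →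
      (P m x y z w ↔ P' m x (y + 1) z w ∧ y < m + 2))
    (hj : ∀ m x z w, ¬ P' m x 0 z w) (n : ℕ) : avoidCount B n = avoidCount B' n := by
  refine avoidCount_eq_of_bij h h' hP hP' (fun p => (p.1 + 1, p.2)) (fun p => (p.1 - 1, p.2))
    (fun m x y z w hx hy hz hw hp => ?_) (fun m x y z w hx hy hz hw hp => ?_) n
  · have := (hi m x y z w hx hy hz hw).1 hp
    exact ⟨by dsimp; omega, hz, this.1, rfl⟩
  · rcases y with _ | y
    · exact absurd hp (hj _ _ _ _)
    · exact ⟨by dsimp; omega, hz, (hi m x y z w hx (by omega) hz hw).2 ⟨hp, by omega⟩, rfl⟩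

/-- The same exchange of neighbouring values, now between the third and the last letter. -/
theorem avoidCount_eq_of_succ_third {B B' : ℕ → ℕ → ℕ → ℕ → ℕ → Bool}
    {P P' : ℕ → ℕ → ℕ → ℕ → ℕ → Prop} (h : NonOverlapping B) (h' : NonOverlapping B')
    (hP : IsWindowCondition B P) (hP' : IsWindowCondition B' P')
    (hi : ∀ m x y z w, x < m + 4 → y < m + 3 → z < m + 2 → w < m + 1 →
      (P m x y z w ↔ P' m x y (z + 1) w ∧ z < m + 1))
    (hj : ∀ m x y w, ¬ P' m x y 0 w) (n : ℕ) : avoidCount B n = avoidCount B' n := by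
  refine avoidCount_eq_of_bij h h' hP hP' (fun p => (p.1, p.2 + 1)) (fun p => (p.1, p.2 - 1))
    (fun m x y z w hx hy hz hw hp => ?_) (fun m x y z w hx hy hz hw hp => ?_) n
  · have := (hi m x y z w hx hy hz hw).1 hp
    exact ⟨hy, by dsimp; omega, this.1, rfl⟩
  · rcases z with _ | z
    · exact absurd hp (hj _ _ _ _)
    · exact ⟨hy, by dsimp; omega, (hi m x y z w hx hy (by omega) hw).2 ⟨hp, by omega⟩, rfl⟩

/-- Exchanging the second and the third letter of a pattern in which they form an ascent. -/
theorem avoidCount_eq_of_swap {B B' : ℕ → ℕ → ℕ → ℕ → ℕ → Bool}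
    {P P' : ℕ → ℕ → ℕ → ℕ → ℕ → Prop} (h : NonOverlapping B) (h' : NonOverlapping B')
    (hP : IsWindowCondition B P) (hP' : IsWindowCondition B' P')
    (hi : ∀ m x y z w, x < m + 4 → y < m + 2 → z < m + 2 → w < m + 1 →
      (P m x y z w ↔ P' m x (z + 1) y w))
    (hy : ∀ m x y z w, z < m + 2 → P m x y z w → y < m + 2)
    (hj : ∀ m x z w, ¬ P' m x 0 z w) (n : ℕ) : avoidCount B n = avoidCount B' n := by
  refine avoidCount_eq_of_bij h h' hP hP' (fun p => (p.2 + 1, p.1)) (fun p => (p.2, p.1 - 1))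
    (fun m x y z w hx _ hz hw hp => ?_) (fun m x y z w hx hy' hz hw hp => ?_) n
  · have hy := hy m x y z w hz hp
    exact ⟨by dsimp; omega, hy, (hi m x y z w hx hy hz hw).1 hp, rfl⟩
  · rcases y with _ | y
    · exact absurd hp (hj _ _ _ _)
    · exact ⟨by dsimp; omega, by dsimp; omega, (hi m x z y w hx hz (by omega) hw).2 hp, rfl⟩

/-! ### Window conditions of the patterns without overlaps in two or three entries -/

theorem windowCondition_12543 : IsWindowCondition (windowBad 1 2 5 4 3) fun _ x y z w =>
    x ≤ y ∧ y < w ∧ w < z := by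
  intro m x y z w hx hy hz hw
  simp only [windowBad_eq_true_iff, windowType, sameOrder₄, sameOrderLast, Bool.and_eq_true,
    sameOrder_eq_true_iff, ltBit_eq, Nat.reduceLT, if_true, if_false]
  -- The window has values `x`, `y + 1`, `z + 2`, `w + 2`, and the last letter can be taken directly
  -- above the second one.
  exact ⟨fun ⟨_, v, _⟩ => by omega, fun _ => ⟨by omega, y + 2, by omega, by omega⟩⟩

/-- As for all types in this group, the ascents stand on one side and the descents on the other.
Such an up-down word has no proper border, so two occurrences share at most one entry. -/
theorem nonOverlapping_12543 : NonOverlapping (windowBad 1 2 5 4 3) := by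
  refine nonOverlapping_windowBad fun x y z w t s => ?_
  simp only [windowType, sameOrder₄, Bool.and_eq_true, sameOrder_eq_true_iff, ltBit_eq,
    Nat.reduceLT, if_true, if_false]
  omega

theorem windowCondition_13542 : IsWindowCondition (windowBad 1 3 5 4 2) fun _ x y z w =>
    x < y ∧ y ≤ w ∧ w < z := by
  intro m x y z w hx hy hz hw
  simp only [windowBad_eq_true_iff, windowType, sameOrder₄, sameOrderLast, Bool.and_eq_true,
    sameOrder_eq_true_iff, ltBit_eq, Nat.reduceLT, if_true, if_false]
  exact ⟨fun ⟨_, v, _⟩ => by omega, fun _ => ⟨by omega, x + 1, by omega, by omega⟩⟩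

theorem nonOverlapping_13542 : NonOverlapping (windowBad 1 3 5 4 2) := by
  refine nonOverlapping_windowBad fun x y z w t s => ?_
  simp only [windowType, sameOrder₄, Bool.and_eq_true, sameOrder_eq_true_iff, ltBit_eq,
    Nat.reduceLT, if_true, if_false]
  omega

theorem windowCondition_14532 : IsWindowCondition (windowBad 1 4 5 3 2) fun _ x y z w =>
    x < w ∧ w < y ∧ y ≤ z := by
  intro m x y z w hx hy hz hw
  simp only [windowBad_eq_true_iff, windowType, sameOrder₄, sameOrderLast, Bool.and_eq_true,
    sameOrder_eq_true_iff, ltBit_eq, Nat.reduceLT, if_true, if_false]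
  exact ⟨fun ⟨_, v, _⟩ => by omega, fun _ => ⟨by omega, x + 1, by omega, by omega⟩⟩

theorem nonOverlapping_14532 : NonOverlapping (windowBad 1 4 5 3 2) := by
  refine nonOverlapping_windowBad fun x y z w t s => ?_
  simp only [windowType, sameOrder₄, Bool.and_eq_true, sameOrder_eq_true_iff, ltBit_eq,
    Nat.reduceLT, if_true, if_false]
  omega

theorem windowCondition_15432 : IsWindowCondition (windowBad 1 5 4 3 2) fun _ x y z w =>
    x < w ∧ w < z ∧ z < y := by
  intro m x y z w hx hy hz hw
  simp only [windowBad_eq_true_iff, windowType, sameOrder₄, sameOrderLast, Bool.and_eq_true,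
    sameOrder_eq_true_iff, ltBit_eq, Nat.reduceLT, if_true, if_false]
  exact ⟨fun ⟨_, v, _⟩ => by omega, fun _ => ⟨by omega, x + 1, by omega, by omega⟩⟩

theorem nonOverlapping_15432 : NonOverlapping (windowBad 1 5 4 3 2) := by
  refine nonOverlapping_windowBad fun x y z w t s => ?_
  simp only [windowType, sameOrder₄, Bool.and_eq_true, sameOrder_eq_true_iff, ltBit_eq,
    Nat.reduceLT, if_true, if_false]
  omega

theorem windowCondition_21354 : IsWindowCondition (windowBad 2 1 3 5 4) fun _ x y z w =>
    y < x ∧ x ≤ z + 1 ∧ z < w := by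
  intro m x y z w hx hy hz hw
  simp only [windowBad_eq_true_iff, windowType, sameOrder₄, sameOrderLast, Bool.and_eq_true,
    sameOrder_eq_true_iff, ltBit_eq, Nat.reduceLT, if_true, if_false]
  exact ⟨fun ⟨_, v, _⟩ => by omega, fun _ => ⟨by omega, z + 3, by omega, by omega⟩⟩

theorem nonOverlapping_21354 : NonOverlapping (windowBad 2 1 3 5 4) := by
  refine nonOverlapping_windowBad fun x y z w t s => ?_
  simp only [windowType, sameOrder₄, Bool.and_eq_true, sameOrder_eq_true_iff, ltBit_eq,
    Nat.reduceLT, if_true, if_false]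
  omega

theorem windowCondition_21453 : IsWindowCondition (windowBad 2 1 4 5 3) fun _ x y z w =>
    y < x ∧ x ≤ z ∧ z ≤ w := by
  intro m x y z w hx hy hz hw
  simp only [windowBad_eq_true_iff, windowType, sameOrder₄, sameOrderLast, Bool.and_eq_true,
    sameOrder_eq_true_iff, ltBit_eq, Nat.reduceLT, if_true, if_false]
  exact ⟨fun ⟨_, v, _⟩ => by omega, fun _ => ⟨by omega, x + 1, by omega, by omega⟩⟩

theorem nonOverlapping_21453 : NonOverlapping (windowBad 2 1 4 5 3) := by
  refine nonOverlapping_windowBad fun x y z w t s => ?_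
  simp only [windowType, sameOrder₄, Bool.and_eq_true, sameOrder_eq_true_iff, ltBit_eq,
    Nat.reduceLT, if_true, if_false]
  omega

theorem windowCondition_12435 : IsWindowCondition (windowBad 1 2 4 3 5) fun m x y z w =>
    x ≤ y ∧ y ≤ w ∧ w < z ∧ z < m + 1 := by
  intro m x y z w hx hy hz hw
  simp only [windowBad_eq_true_iff, windowType, sameOrder₄, sameOrderLast, Bool.and_eq_true,
    sameOrder_eq_true_iff, ltBit_eq, Nat.reduceLT, if_true, if_false]
  -- For a largest last letter the witness is the maximum of the suffix.
  exact ⟨fun ⟨_, v, _⟩ => by omega, fun _ => ⟨by omega, m + 3, by omega, by omega⟩⟩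

theorem nonOverlapping_12435 : NonOverlapping (windowBad 1 2 4 3 5) := by
  refine nonOverlapping_windowBad fun x y z w t s => ?_
  simp only [windowType, sameOrder₄, Bool.and_eq_true, sameOrder_eq_true_iff, ltBit_eq,
    Nat.reduceLT, if_true, if_false]
  omega

theorem windowCondition_12534 : IsWindowCondition (windowBad 1 2 5 3 4) fun _ x y z w =>
    x ≤ y ∧ y ≤ w ∧ w + 1 < z := by
  intro m x y z w hx hy hz hw
  simp only [windowBad_eq_true_iff, windowType, sameOrder₄, sameOrderLast, Bool.and_eq_true,
    sameOrder_eq_true_iff, ltBit_eq, Nat.reduceLT, if_true, if_false]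
  exact ⟨fun ⟨_, v, _⟩ => by omega, fun _ => ⟨by omega, w + 3, by omega, by omega⟩⟩

theorem nonOverlapping_12534 : NonOverlapping (windowBad 1 2 5 3 4) := by
  refine nonOverlapping_windowBad fun x y z w t s => ?_
  simp only [windowType, sameOrder₄, Bool.and_eq_true, sameOrder_eq_true_iff, ltBit_eq,
    Nat.reduceLT, if_true, if_false]
  omega

theorem windowCondition_32451 : IsWindowCondition (windowBad 3 2 4 5 1) fun _ x y z w =>
    0 < y ∧ y < x ∧ x ≤ z + 1 ∧ z ≤ w := by
  intro m x y z w hx hy hz hw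
  simp only [windowBad_eq_true_iff, windowType, sameOrder₄, sameOrderLast, Bool.and_eq_true,
    sameOrder_eq_true_iff, ltBit_eq, Nat.reduceLT, if_true, if_false]
  exact ⟨fun ⟨_, v, _⟩ => by omega, fun _ => ⟨by omega, 0, by omega, by omega⟩⟩

theorem nonOverlapping_32451 : NonOverlapping (windowBad 3 2 4 5 1) := by
  refine nonOverlapping_windowBad fun x y z w t s => ?_
  simp only [windowType, sameOrder₄, Bool.and_eq_true, sameOrder_eq_true_iff, ltBit_eq,
    Nat.reduceLT, if_true, if_false]
  omega

theorem windowCondition_31452 : IsWindowCondition (windowBad 3 1 4 5 2) fun _ x y z w =>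
    y + 1 < x ∧ x ≤ z + 1 ∧ z ≤ w := by
  intro m x y z w hx hy hz hw
  simp only [windowBad_eq_true_iff, windowType, sameOrder₄, sameOrderLast, Bool.and_eq_true,
    sameOrder_eq_true_iff, ltBit_eq, Nat.reduceLT, if_true, if_false]
  exact ⟨fun ⟨_, v, _⟩ => by omega, fun _ => ⟨by omega, y + 1, by omega, by omega⟩⟩

theorem nonOverlapping_31452 : NonOverlapping (windowBad 3 1 4 5 2) := by
  refine nonOverlapping_windowBad fun x y z w t s => ?_
  simp only [windowType, sameOrder₄, Bool.and_eq_true, sameOrder_eq_true_iff, ltBit_eq,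
    Nat.reduceLT, if_true, if_false]
  omega

theorem windowCondition_31254 : IsWindowCondition (windowBad 3 1 2 5 4) fun _ x y z w =>
    y ≤ z ∧ z + 1 < x ∧ x ≤ w + 1 := by
  intro m x y z w hx hy hz hw
  simp only [windowBad_eq_true_iff, windowType, sameOrder₄, sameOrderLast, Bool.and_eq_true,
    sameOrder_eq_true_iff, ltBit_eq, Nat.reduceLT, if_true, if_false]
  exact ⟨fun ⟨_, v, _⟩ => by omega, fun _ => ⟨by omega, x + 1, by omega, by omega⟩⟩

theorem nonOverlapping_31254 : NonOverlapping (windowBad 3 1 2 5 4) := by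
  refine nonOverlapping_windowBad fun x y z w t s => ?_
  simp only [windowType, sameOrder₄, Bool.and_eq_true, sameOrder_eq_true_iff, ltBit_eq,
    Nat.reduceLT, if_true, if_false]
  omega

theorem windowCondition_32154 : IsWindowCondition (windowBad 3 2 1 5 4) fun _ x y z w =>
    z < y ∧ y < x ∧ x ≤ w + 1 := by
  intro m x y z w hx hy hz hw
  simp only [windowBad_eq_true_iff, windowType, sameOrder₄, sameOrderLast, Bool.and_eq_true,
    sameOrder_eq_true_iff, ltBit_eq, Nat.reduceLT, if_true, if_false]
  exact ⟨fun ⟨_, v, _⟩ => by omega, fun _ => ⟨by omega, x + 1, by omega, by omega⟩⟩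

theorem nonOverlapping_32154 : NonOverlapping (windowBad 3 2 1 5 4) := by
  refine nonOverlapping_windowBad fun x y z w t s => ?_
  simp only [windowType, sameOrder₄, Bool.and_eq_true, sameOrder_eq_true_iff, ltBit_eq,
    Nat.reduceLT, if_true, if_false]
  omega

theorem windowCondition_13425 : IsWindowCondition (windowBad 1 3 4 2 5) fun m x y z w =>
    x ≤ w ∧ w < y ∧ y ≤ z ∧ z < m + 1 := by
  intro m x y z w hx hy hz hw
  simp only [windowBad_eq_true_iff, windowType, sameOrder₄, sameOrderLast, Bool.and_eq_true,
    sameOrder_eq_true_iff, ltBit_eq, Nat.reduceLT, if_true, if_false]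
  exact ⟨fun ⟨_, v, _⟩ => by omega, fun _ => ⟨by omega, m + 3, by omega, by omega⟩⟩

theorem nonOverlapping_13425 : NonOverlapping (windowBad 1 3 4 2 5) := by
  refine nonOverlapping_windowBad fun x y z w t s => ?_
  simp only [windowType, sameOrder₄, Bool.and_eq_true, sameOrder_eq_true_iff, ltBit_eq,
    Nat.reduceLT, if_true, if_false]
  omega

theorem windowCondition_13524 : IsWindowCondition (windowBad 1 3 5 2 4) fun _ x y z w =>
    x ≤ w ∧ w < y ∧ y < z := by
  intro m x y z w hx hy hz hw
  simp only [windowBad_eq_true_iff, windowType, sameOrder₄, sameOrderLast, Bool.and_eq_true,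
    sameOrder_eq_true_iff, ltBit_eq, Nat.reduceLT, if_true, if_false]
  exact ⟨fun ⟨_, v, _⟩ => by omega, fun _ => ⟨by omega, y + 2, by omega, by omega⟩⟩

theorem nonOverlapping_13524 : NonOverlapping (windowBad 1 3 5 2 4) := by
  refine nonOverlapping_windowBad fun x y z w t s => ?_
  simp only [windowType, sameOrder₄, Bool.and_eq_true, sameOrder_eq_true_iff, ltBit_eq,
    Nat.reduceLT, if_true, if_false]
  omega

theorem windowCondition_14523 : IsWindowCondition (windowBad 1 4 5 2 3) fun _ x y z w =>
    x ≤ w ∧ w + 1 < y ∧ y ≤ z := by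
  intro m x y z w hx hy hz hw
  simp only [windowBad_eq_true_iff, windowType, sameOrder₄, sameOrderLast, Bool.and_eq_true,
    sameOrder_eq_true_iff, ltBit_eq, Nat.reduceLT, if_true, if_false]
  exact ⟨fun ⟨_, v, _⟩ => by omega, fun _ => ⟨by omega, w + 2, by omega, by omega⟩⟩

theorem nonOverlapping_14523 : NonOverlapping (windowBad 1 4 5 2 3) := by
  refine nonOverlapping_windowBad fun x y z w t s => ?_
  simp only [windowType, sameOrder₄, Bool.and_eq_true, sameOrder_eq_true_iff, ltBit_eq,
    Nat.reduceLT, if_true, if_false]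
  omega

theorem windowCondition_14325 : IsWindowCondition (windowBad 1 4 3 2 5) fun m x y z w =>
    x ≤ w ∧ w < z ∧ z < y ∧ y < m + 2 := by
  intro m x y z w hx hy hz hw
  simp only [windowBad_eq_true_iff, windowType, sameOrder₄, sameOrderLast, Bool.and_eq_true,
    sameOrder_eq_true_iff, ltBit_eq, Nat.reduceLT, if_true, if_false]
  exact ⟨fun ⟨_, v, _⟩ => by omega, fun _ => ⟨by omega, m + 3, by omega, by omega⟩⟩

theorem nonOverlapping_14325 : NonOverlapping (windowBad 1 4 3 2 5) := by
  refine nonOverlapping_windowBad fun x y z w t s => ?_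
  simp only [windowType, sameOrder₄, Bool.and_eq_true, sameOrder_eq_true_iff, ltBit_eq,
    Nat.reduceLT, if_true, if_false]
  omega

theorem windowCondition_15324 : IsWindowCondition (windowBad 1 5 3 2 4) fun _ x y z w =>
    x ≤ w ∧ w < z ∧ z + 1 < y := by
  intro m x y z w hx hy hz hw
  simp only [windowBad_eq_true_iff, windowType, sameOrder₄, sameOrderLast, Bool.and_eq_true,
    sameOrder_eq_true_iff, ltBit_eq, Nat.reduceLT, if_true, if_false]
  exact ⟨fun ⟨_, v, _⟩ => by omega, fun _ => ⟨by omega, z + 2, by omega, by omega⟩⟩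

theorem nonOverlapping_15324 : NonOverlapping (windowBad 1 5 3 2 4) := by
  refine nonOverlapping_windowBad fun x y z w t s => ?_
  simp only [windowType, sameOrder₄, Bool.and_eq_true, sameOrder_eq_true_iff, ltBit_eq,
    Nat.reduceLT, if_true, if_false]
  omega

theorem windowCondition_15423 : IsWindowCondition (windowBad 1 5 4 2 3) fun _ x y z w =>
    x ≤ w ∧ w + 1 < z ∧ z < y := by
  intro m x y z w hx hy hz hw
  simp only [windowBad_eq_true_iff, windowType, sameOrder₄, sameOrderLast, Bool.and_eq_true,
    sameOrder_eq_true_iff, ltBit_eq, Nat.reduceLT, if_true, if_false]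
  exact ⟨fun ⟨_, v, _⟩ => by omega, fun _ => ⟨by omega, w + 2, by omega, by omega⟩⟩

theorem nonOverlapping_15423 : NonOverlapping (windowBad 1 5 4 2 3) := by
  refine nonOverlapping_windowBad fun x y z w t s => ?_
  simp only [windowType, sameOrder₄, Bool.and_eq_true, sameOrder_eq_true_iff, ltBit_eq,
    Nat.reduceLT, if_true, if_false]
  omega

theorem windowCondition_23415 : IsWindowCondition (windowBad 2 3 4 1 5) fun m x y z w =>
    w < x ∧ x ≤ y ∧ y ≤ z ∧ z < m + 1 := by
  intro m x y z w hx hy hz hw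
  simp only [windowBad_eq_true_iff, windowType, sameOrder₄, sameOrderLast, Bool.and_eq_true,
    sameOrder_eq_true_iff, ltBit_eq, Nat.reduceLT, if_true, if_false]
  exact ⟨fun ⟨_, v, _⟩ => by omega, fun _ => ⟨by omega, m + 3, by omega, by omega⟩⟩

theorem nonOverlapping_23415 : NonOverlapping (windowBad 2 3 4 1 5) := by
  refine nonOverlapping_windowBad fun x y z w t s => ?_
  simp only [windowType, sameOrder₄, Bool.and_eq_true, sameOrder_eq_true_iff, ltBit_eq,
    Nat.reduceLT, if_true, if_false]
  omega

theorem windowCondition_23514 : IsWindowCondition (windowBad 2 3 5 1 4) fun _ x y z w =>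
    w < x ∧ x ≤ y ∧ y < z := by
  intro m x y z w hx hy hz hw
  simp only [windowBad_eq_true_iff, windowType, sameOrder₄, sameOrderLast, Bool.and_eq_true,
    sameOrder_eq_true_iff, ltBit_eq, Nat.reduceLT, if_true, if_false]
  exact ⟨fun ⟨_, v, _⟩ => by omega, fun _ => ⟨by omega, y + 2, by omega, by omega⟩⟩

theorem nonOverlapping_23514 : NonOverlapping (windowBad 2 3 5 1 4) := by
  refine nonOverlapping_windowBad fun x y z w t s => ?_
  simp only [windowType, sameOrder₄, Bool.and_eq_true, sameOrder_eq_true_iff, ltBit_eq,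
    Nat.reduceLT, if_true, if_false]
  omega

theorem windowCondition_24513 : IsWindowCondition (windowBad 2 4 5 1 3) fun _ x y z w =>
    w < x ∧ x < y ∧ y ≤ z := by
  intro m x y z w hx hy hz hw
  simp only [windowBad_eq_true_iff, windowType, sameOrder₄, sameOrderLast, Bool.and_eq_true,
    sameOrder_eq_true_iff, ltBit_eq, Nat.reduceLT, if_true, if_false]
  exact ⟨fun ⟨_, v, _⟩ => by omega, fun _ => ⟨by omega, x + 1, by omega, by omega⟩⟩

theorem nonOverlapping_24513 : NonOverlapping (windowBad 2 4 5 1 3) := by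
  refine nonOverlapping_windowBad fun x y z w t s => ?_
  simp only [windowType, sameOrder₄, Bool.and_eq_true, sameOrder_eq_true_iff, ltBit_eq,
    Nat.reduceLT, if_true, if_false]
  omega

theorem windowCondition_24315 : IsWindowCondition (windowBad 2 4 3 1 5) fun m x y z w =>
    w < x ∧ x ≤ z ∧ z < y ∧ y < m + 2 := by
  intro m x y z w hx hy hz hw
  simp only [windowBad_eq_true_iff, windowType, sameOrder₄, sameOrderLast, Bool.and_eq_true,
    sameOrder_eq_true_iff, ltBit_eq, Nat.reduceLT, if_true, if_false]
  exact ⟨fun ⟨_, v, _⟩ => by omega, fun _ => ⟨by omega, m + 3, by omega, by omega⟩⟩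

theorem nonOverlapping_24315 : NonOverlapping (windowBad 2 4 3 1 5) := by
  refine nonOverlapping_windowBad fun x y z w t s => ?_
  simp only [windowType, sameOrder₄, Bool.and_eq_true, sameOrder_eq_true_iff, ltBit_eq,
    Nat.reduceLT, if_true, if_false]
  omega

theorem windowCondition_25314 : IsWindowCondition (windowBad 2 5 3 1 4) fun _ x y z w =>
    w < x ∧ x ≤ z ∧ z + 1 < y := by
  intro m x y z w hx hy hz hw
  simp only [windowBad_eq_true_iff, windowType, sameOrder₄, sameOrderLast, Bool.and_eq_true,
    sameOrder_eq_true_iff, ltBit_eq, Nat.reduceLT, if_true, if_false]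
  exact ⟨fun ⟨_, v, _⟩ => by omega, fun _ => ⟨by omega, z + 2, by omega, by omega⟩⟩

theorem nonOverlapping_25314 : NonOverlapping (windowBad 2 5 3 1 4) := by
  refine nonOverlapping_windowBad fun x y z w t s => ?_
  simp only [windowType, sameOrder₄, Bool.and_eq_true, sameOrder_eq_true_iff, ltBit_eq,
    Nat.reduceLT, if_true, if_false]
  omega

theorem windowCondition_25413 : IsWindowCondition (windowBad 2 5 4 1 3) fun _ x y z w =>
    w < x ∧ x < z ∧ z < y := by
  intro m x y z w hx hy hz hw
  simp only [windowBad_eq_true_iff, windowType, sameOrder₄, sameOrderLast, Bool.and_eq_true,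
    sameOrder_eq_true_iff, ltBit_eq, Nat.reduceLT, if_true, if_false]
  exact ⟨fun ⟨_, v, _⟩ => by omega, fun _ => ⟨by omega, x + 1, by omega, by omega⟩⟩

theorem nonOverlapping_25413 : NonOverlapping (windowBad 2 5 4 1 3) := by
  refine nonOverlapping_windowBad fun x y z w t s => ?_
  simp only [windowType, sameOrder₄, Bool.and_eq_true, sameOrder_eq_true_iff, ltBit_eq,
    Nat.reduceLT, if_true, if_false]
  omega

/-! ### Equalities between individual patterns -/

theorem avoidCount_12543_eq_13542 (n : ℕ) :
    avoidCount (windowBad 1 2 5 4 3) n = avoidCount (windowBad 1 3 5 4 2) n :=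
  avoidCount_eq_of_succ_second nonOverlapping_12543 nonOverlapping_13542
    windowCondition_12543 windowCondition_13542 (by omega) (by omega) n

theorem avoidCount_14532_eq_15432 (n : ℕ) :
    avoidCount (windowBad 1 4 5 3 2) n = avoidCount (windowBad 1 5 4 3 2) n :=
  avoidCount_eq_of_swap nonOverlapping_14532 nonOverlapping_15432
    windowCondition_14532 windowCondition_15432 (by omega) (by omega) (by omega) n

theorem avoidCount_21354_eq_21453 (n : ℕ) :
    avoidCount (windowBad 2 1 3 5 4) n = avoidCount (windowBad 2 1 4 5 3) n :=
  avoidCount_eq_of_succ_third nonOverlapping_21354 nonOverlapping_21453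
    windowCondition_21354 windowCondition_21453 (by omega) (by omega) n

theorem avoidCount_12435_eq_12534 (n : ℕ) :
    avoidCount (windowBad 1 2 4 3 5) n = avoidCount (windowBad 1 2 5 3 4) n :=
  avoidCount_eq_of_succ_third nonOverlapping_12435 nonOverlapping_12534
    windowCondition_12435 windowCondition_12534 (by omega) (by omega) n

theorem avoidCount_31452_eq_32451 (n : ℕ) :
    avoidCount (windowBad 3 1 4 5 2) n = avoidCount (windowBad 3 2 4 5 1) n :=
  avoidCount_eq_of_succ_second nonOverlapping_31452 nonOverlapping_32451
    windowCondition_31452 windowCondition_32451 (by omega) (by omega) n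

theorem avoidCount_31254_eq_32154 (n : ℕ) :
    avoidCount (windowBad 3 1 2 5 4) n = avoidCount (windowBad 3 2 1 5 4) n :=
  avoidCount_eq_of_swap nonOverlapping_31254 nonOverlapping_32154
    windowCondition_31254 windowCondition_32154 (by omega) (by omega) (by omega) n

theorem avoidCount_13425_eq_13524 (n : ℕ) :
    avoidCount (windowBad 1 3 4 2 5) n = avoidCount (windowBad 1 3 5 2 4) n :=
  avoidCount_eq_of_succ_third nonOverlapping_13425 nonOverlapping_13524
    windowCondition_13425 windowCondition_13524 (by omega) (by omega) n

theorem avoidCount_13524_eq_14523 (n : ℕ) :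
    avoidCount (windowBad 1 3 5 2 4) n = avoidCount (windowBad 1 4 5 2 3) n :=
  avoidCount_eq_of_succ_second nonOverlapping_13524 nonOverlapping_14523
    windowCondition_13524 windowCondition_14523 (by omega) (by omega) n

theorem avoidCount_13425_eq_14325 (n : ℕ) :
    avoidCount (windowBad 1 3 4 2 5) n = avoidCount (windowBad 1 4 3 2 5) n :=
  avoidCount_eq_of_swap nonOverlapping_13425 nonOverlapping_14325
    windowCondition_13425 windowCondition_14325 (by omega) (by omega) (by omega) n

theorem avoidCount_13524_eq_15324 (n : ℕ) :
    avoidCount (windowBad 1 3 5 2 4) n = avoidCount (windowBad 1 5 3 2 4) n :=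
  avoidCount_eq_of_swap nonOverlapping_13524 nonOverlapping_15324
    windowCondition_13524 windowCondition_15324 (by omega) (by omega) (by omega) n

theorem avoidCount_14523_eq_15423 (n : ℕ) :
    avoidCount (windowBad 1 4 5 2 3) n = avoidCount (windowBad 1 5 4 2 3) n :=
  avoidCount_eq_of_swap nonOverlapping_14523 nonOverlapping_15423
    windowCondition_14523 windowCondition_15423 (by omega) (by omega) (by omega) n

theorem avoidCount_23415_eq_23514 (n : ℕ) :
    avoidCount (windowBad 2 3 4 1 5) n = avoidCount (windowBad 2 3 5 1 4) n :=
  avoidCount_eq_of_succ_third nonOverlapping_23415 nonOverlapping_23514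
    windowCondition_23415 windowCondition_23514 (by omega) (by omega) n

theorem avoidCount_23514_eq_24513 (n : ℕ) :
    avoidCount (windowBad 2 3 5 1 4) n = avoidCount (windowBad 2 4 5 1 3) n :=
  avoidCount_eq_of_succ_second nonOverlapping_23514 nonOverlapping_24513
    windowCondition_23514 windowCondition_24513 (by omega) (by omega) n

theorem avoidCount_23415_eq_24315 (n : ℕ) :
    avoidCount (windowBad 2 3 4 1 5) n = avoidCount (windowBad 2 4 3 1 5) n :=
  avoidCount_eq_of_swap nonOverlapping_23415 nonOverlapping_24315
    windowCondition_23415 windowCondition_24315 (by omega) (by omega) (by omega) n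

theorem avoidCount_23514_eq_25314 (n : ℕ) :
    avoidCount (windowBad 2 3 5 1 4) n = avoidCount (windowBad 2 5 3 1 4) n :=
  avoidCount_eq_of_swap nonOverlapping_23514 nonOverlapping_25314
    windowCondition_23514 windowCondition_25314 (by omega) (by omega) (by omega) n

theorem avoidCount_24513_eq_25413 (n : ℕ) :
    avoidCount (windowBad 2 4 5 1 3) n = avoidCount (windowBad 2 5 4 1 3) n :=
  avoidCount_eq_of_swap nonOverlapping_24513 nonOverlapping_25413
    windowCondition_24513 windowCondition_25413 (by omega) (by omega) (by omega) n

/-- Both types are 2143. The last letter lies inside the first descent for 3154-2 and inside the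
second one for 2153-4, and makes that descent wide. -/
theorem avoidCount_31542_eq_21534 (n : ℕ) :
    avoidCount (windowBad 3 1 5 4 2) n = avoidCount (windowBad 2 1 5 3 4) n := by
  refine TwoDescents.avoidCount_eq ⟨?_, ?_, fun _ _ => by omega, fun _ _ => id⟩
    ⟨?_, ?_, fun _ _ => id, fun _ _ => by omega⟩ n
  · intro m x y z w hx hy hz hw
    simp only [windowBad_eq_true_iff, windowType, sameOrder₄, sameOrderLast, Bool.and_eq_true,
      sameOrder_eq_true_iff, ltBit_eq, Nat.reduceLT, if_true, if_false]
    exact ⟨fun ⟨_, v, _⟩ => by omega, fun _ => ⟨by omega, y + 1, by omega, by omega⟩⟩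
  · intro m x y z w
    simp only [windowBad_eq_true_iff, windowType, sameOrder₄, Bool.and_eq_true,
      sameOrder_eq_true_iff, ltBit_eq, Nat.reduceLT, if_true, if_false]
    omega
  · intro m x y z w hx hy hz hw
    simp only [windowBad_eq_true_iff, windowType, sameOrder₄, sameOrderLast, Bool.and_eq_true,
      sameOrder_eq_true_iff, ltBit_eq, Nat.reduceLT, if_true, if_false]
    exact ⟨fun ⟨_, v, _⟩ => by omega, fun _ => ⟨by omega, w + 3, by omega, by omega⟩⟩
  · intro m x y z w
    simp only [windowBad_eq_true_iff, windowType, sameOrder₄, Bool.and_eq_true,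
      sameOrder_eq_true_iff, ltBit_eq, Nat.reduceLT, if_true, if_false]
    omega

/-- The last letter lies between two neighbouring letters of the increasing window and makes that
step strict in the code. In the three patterns it is the first, the second and the third step,
respectively. -/
theorem runFormula_13452 : RunFormula (windowBad 1 3 4 5 2) := by
  refine runFormula_wideFirstStep ?_ ?_ ?_
  · intro m x y z w hw
    simp only [windowBad_eq_true_iff, windowType, sameOrder₄, sameOrderLast, Bool.and_eq_true,
      sameOrder_eq_true_iff, ltBit_eq, Nat.reduceLT, if_true, if_false]
    exact ⟨fun ⟨_, v, _⟩ => by omega, fun _ => ⟨by omega, x + 1, by omega, by omega⟩⟩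
  · intro m x y z w
    simp only [windowBad_eq_true_iff, windowType, sameOrder₄, sameOrderLast, Bool.and_eq_true,
      sameOrder_eq_true_iff, ltBit_eq, Nat.reduceLT, if_true, if_false]
    omega
  · intro m x y z w
    simp only [windowBad_eq_true_iff, windowType, sameOrder₄, sameOrderLast, Bool.and_eq_true,
      sameOrder_eq_true_iff, ltBit_eq, Nat.reduceLT, if_true, if_false]
    rintro ⟨_, v, _⟩
    omega

theorem runFormula_12453 : RunFormula (windowBad 1 2 4 5 3) := by
  refine runFormula_wideSecondStep ?_ ?_ ?_
  · intro m x y z w hw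
    simp only [windowBad_eq_true_iff, windowType, sameOrder₄, sameOrderLast, Bool.and_eq_true,
      sameOrder_eq_true_iff, ltBit_eq, Nat.reduceLT, if_true, if_false]
    exact ⟨fun ⟨_, v, _⟩ => by omega, fun _ => ⟨by omega, y + 2, by omega, by omega⟩⟩
  · intro m x y z w
    simp only [windowBad_eq_true_iff, windowType, sameOrder₄, sameOrderLast, Bool.and_eq_true,
      sameOrder_eq_true_iff, ltBit_eq, Nat.reduceLT, if_true, if_false]
    omega
  · intro m x y z w
    simp only [windowBad_eq_true_iff, windowType, sameOrder₄, sameOrderLast, Bool.and_eq_true,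
      sameOrder_eq_true_iff, ltBit_eq, Nat.reduceLT, if_true, if_false]
    rintro ⟨_, v, _⟩
    omega

theorem runFormula_12354 : RunFormula (windowBad 1 2 3 5 4) := by
  refine runFormula_wideThirdStep ?_ ?_ ?_
  · intro m x y z w hw
    simp only [windowBad_eq_true_iff, windowType, sameOrder₄, sameOrderLast, Bool.and_eq_true,
      sameOrder_eq_true_iff, ltBit_eq, Nat.reduceLT, if_true, if_false]
    exact ⟨fun ⟨_, v, _⟩ => by omega, fun _ => ⟨by omega, z + 3, by omega, by omega⟩⟩
  · intro m x y z w
    simp only [windowBad_eq_true_iff, windowType, sameOrder₄, sameOrderLast, Bool.and_eq_true,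
      sameOrder_eq_true_iff, ltBit_eq, Nat.reduceLT, if_true, if_false]
    omega
  · intro m x y z w
    simp only [windowBad_eq_true_iff, windowType, sameOrder₄, sameOrderLast, Bool.and_eq_true,
      sameOrder_eq_true_iff, ltBit_eq, Nat.reduceLT, if_true, if_false]
    rintro ⟨_, v, _⟩
    omega

/-! ### The classification -/

/-- The number of permutations of `n` letters that avoid the pattern `abcd-e` with word `abcde`. -/
def wordCount (l : List ℕ) (n : ℕ) : ℕ :=
  match l with
  | [a, b, c, d, e] => avoidCount (windowBad a b c d e) n
  | _ => 0

/-- The quasi-consecutive pattern of length five with a given permutation. -/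
def QuasiConsecutivePattern.ofPerm (σ : Equiv.Perm (Fin 5)) : QuasiConsecutivePattern 5 :=
  ⟨⟨σ, {j | (j : ℕ) + 2 < 5}⟩, fun _ => Iff.rfl⟩

theorem VincularPattern.ncard_avoiders_eq_wordCount {p : VincularPattern 5}
    (hp : p.IsQuasiConsecutive) (n : ℕ) : (p.avoiders n).ncard = wordCount p.word n := by
  rw [word_eq]
  exact ncard_avoiders hp n

theorem VincularPattern.word_complement (p : VincularPattern 5) :
    p.complement.word = p.word.map (6 - ·) := by
  simp only [word, complement, List.map_ofFn, Function.comp_def, Equiv.trans_apply,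
    Fin.revPerm_apply, Fin.val_rev]
  congr 1
  funext i
  omega

theorem wordCount_complement {l : List ℕ}
    (h : ∃ σ : Equiv.Perm (Fin 5), (List.ofFn fun i => (σ i : ℕ) + 1) = l) (n : ℕ) :
    wordCount l n = wordCount (l.map (6 - ·)) n := by
  obtain ⟨σ, rfl⟩ := h
  let p := QuasiConsecutivePattern.ofPerm σ
  have h1 := VincularPattern.ncard_avoiders_eq_wordCount p.2 n
  have h2 := VincularPattern.ncard_avoiders_eq_wordCount (p := p.1.complement) p.2 n
  rw [VincularPattern.ncard_avoiders_complement, h1, VincularPattern.word_complement] at h2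
  exact h2

theorem wordCount_eq_headD (n : ℕ) :
    ∀ row ∈ classTable, ∀ l ∈ row, wordCount l n = wordCount (row.headD []) n := by
  have h12543 := avoidCount_12543_eq_13542 n
  have h14532 := avoidCount_14532_eq_15432 n
  have h21354 := avoidCount_21354_eq_21453 n
  have h12435 := avoidCount_12435_eq_12534 n
  have h31452 := avoidCount_31452_eq_32451 n
  have h31254 := avoidCount_31254_eq_32154 n
  have h13425 := avoidCount_13425_eq_13524 n
  have h13524 := avoidCount_13524_eq_14523 n
  have h13425 := avoidCount_13425_eq_14325 n
  have h13524 := avoidCount_13524_eq_15324 n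
  have h14523 := avoidCount_14523_eq_15423 n
  have h23415 := avoidCount_23415_eq_23514 n
  have h23514 := avoidCount_23514_eq_24513 n
  have h23415 := avoidCount_23415_eq_24315 n
  have h23514 := avoidCount_23514_eq_25314 n
  have h24513 := avoidCount_24513_eq_25413 n
  have h31542 := avoidCount_31542_eq_21534 n
  have h13452 := runFormula_13452.avoidCount_eq runFormula_12453 n
  have h12453 := runFormula_12453.avoidCount_eq runFormula_12354 n
  have t1243 := avoidCount_top_eq_bottom (a := 1) (b := 2) (c := 4) (d := 3) (e := 5)
    (by decide) (by decide) (by decide) n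
  have t2134 := avoidCount_top_eq_bottom (a := 2) (b := 1) (c := 3) (d := 4) (e := 5)
    (by decide) (by decide) (by decide) n
  have t1342 := avoidCount_top_eq_bottom (a := 1) (b := 3) (c := 4) (d := 2) (e := 5)
    (by decide) (by decide) (by decide) n
  have t1432 := avoidCount_top_eq_bottom (a := 1) (b := 4) (c := 3) (d := 2) (e := 5)
    (by decide) (by decide) (by decide) n
  have t2431 := avoidCount_top_eq_bottom (a := 2) (b := 4) (c := 3) (d := 1) (e := 5)
    (by decide) (by decide) (by decide) n
  have t2341 := avoidCount_top_eq_bottom (a := 2) (b := 3) (c := 4) (d := 1) (e := 5)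
    (by decide) (by decide) (by decide) n
  have t1423 := avoidCount_top_eq_bottom (a := 1) (b := 4) (c := 2) (d := 3) (e := 5)
    (by decide) (by decide) (by decide) n
  have t3241 := avoidCount_top_eq_bottom (a := 3) (b := 2) (c := 4) (d := 1) (e := 5)
    (by decide) (by decide) (by decide) n
  have t2143 := avoidCount_top_eq_bottom (a := 2) (b := 1) (c := 4) (d := 3) (e := 5)
    (by decide) (by decide) (by decide) n
  have t1324 := avoidCount_top_eq_bottom (a := 1) (b := 3) (c := 2) (d := 4) (e := 5)
    (by decide) (by decide) (by decide) n
  have t1234 := avoidCount_top_eq_bottom (a := 1) (b := 2) (c := 3) (d := 4) (e := 5)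
    (by decide) (by decide) (by decide) n
  -- Neither 3421-5 nor 4532-1 is recorded in the table. They link 1243-5, by reversal, to 2134-5,
  -- whose complement is 4532-1.
  have t3421 := avoidCount_top_eq_bottom (a := 3) (b := 4) (c := 2) (d := 1) (e := 5)
    (by decide) (by decide) (by decide) n
  have r1243 := avoidCount_top_reverse (a := 1) (b := 2) (c := 4) (d := 3) (e := 5)
    (by decide) (by decide) n
  have r1342 := avoidCount_top_reverse (a := 1) (b := 3) (c := 4) (d := 2) (e := 5)
    (by decide) (by decide) n
  have r1423 := avoidCount_top_reverse (a := 1) (b := 4) (c := 2) (d := 3) (e := 5)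
    (by decide) (by decide) n
  have r2413 := avoidCount_top_reverse (a := 2) (b := 4) (c := 1) (d := 3) (e := 5)
    (by decide) (by decide) n
  -- These complements have smallest last letter and are reached from the reversed patterns by the
  -- cyclic shift. This brings in 2134-5, 3124-5, 3214-5 and 2314-5.
  have c21345 := wordCount_complement (l := [2, 1, 3, 4, 5]) (by decide) n
  have c31245 := wordCount_complement (l := [3, 1, 2, 4, 5]) (by decide) n
  have c32145 := wordCount_complement (l := [3, 2, 1, 4, 5]) (by decide) n
  have c23145 := wordCount_complement (l := [2, 3, 1, 4, 5]) (by decide) n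
  simp only [classTable, List.forall_mem_cons, List.not_mem_nil, false_implies, implies_true,
    and_true, true_and, List.headD_cons, wordCount, List.map_cons, List.map_nil, Nat.reduceAdd, Nat.reduceSub] at *
  and_intros <;> omega

/-! ### Separation of the classes by their counts for ten letters -/

/-- The entries `x, y, z` of a code begin an occurrence of the consecutive pattern `abc`. -/
def windowType₃ (a b c x y z : ℕ) : Bool :=
  sameOrder a b x (y + ltBit a b) &&
    (sameOrder b c (y + ltBit a b) (z + (ltBit a c + ltBit b c)) &&
      sameOrder a c x (z + (ltBit a c + ltBit b c)))

theorem windowBad_of_windowType₃ {a b c d e m x y z w : ℕ} (h : windowType₃ a b c x y z = false) :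
    windowBad a b c d e m x y z w = false := by
  rw [← Bool.not_eq_true] at h ⊢
  simp only [windowType₃, windowBad, windowType, sameOrder₄, Bool.and_eq_true] at h ⊢
  exact fun h' => h ⟨h'.1.1, h'.1.2.1, h'.1.2.2.2.1⟩

/-- The number of permutations of ten letters that avoid a pattern, by dynamic programming. -/
def wordCountTen (l : List ℕ) : ℕ :=
  match l with
  | [a, b, c, d, e] =>
    ((countTable (windowBad a b c d e) (windowType₃ a b c) 7).map
      fun l => (l.map List.sum).sum).sum
  | _ => 0

theorem wordCount_ten (l : List ℕ) : wordCount l 10 = wordCountTen l := by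
  unfold wordCount wordCountTen
  split
  · exact avoidCount_eq_sum_countTable _ (fun _ _ _ _ _ => windowBad_of_windowType₃) 7
  · rfl

/-- The 26 values are pairwise different, so a single length separates all rows. -/
theorem map_wordCountTen_classTable :
    classTable.map (fun row => wordCountTen (row.headD [])) =
      [3236090, 3236740, 3236426, 3237362, 3237698, 3237620, 3238028, 3238886,
        3238891, 3239356, 3239412, 3240416, 3241219, 3243505, 3241738, 3242069,
        3242738, 3243252, 3245568, 3246798, 3247036, 3247430, 3249227, 3251054,
        3253240, 3289057] := by
  decide +kernel

theorem classTable_eq_of_wordCount_eq {row row' : List (List ℕ)} (h : row ∈ classTable)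
    (h' : row' ∈ classTable) (he : wordCount (row.headD []) 10 = wordCount (row'.headD []) 10) :
    row = row' := by
  rw [wordCount_ten, wordCount_ten] at he
  refine List.inj_on_of_nodup_map (f := fun row => wordCountTen (row.headD [])) ?_ h h' he
  rw [map_wordCountTen_classTable]
  decide

theorem exists_mem_classTable : ∀ σ : Equiv.Perm (Fin 5), ∃ row ∈ classTable,
    (List.ofFn fun i => (σ i : ℕ) + 1) ∈ row ∨
      ((List.ofFn fun i => (σ i : ℕ) + 1).map (6 - ·)) ∈ row := by
  decide +kernel

theorem exists_word_mem_row : ∀ row ∈ classTable,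
    ∃ σ : Equiv.Perm (Fin 5), (List.ofFn fun i => (σ i : ℕ) + 1) ∈ row := by
  decide +kernel

theorem ncard_avoiders_of_mem_tableClass {row : List (List ℕ)} (h : row ∈ classTable)
    {p : QuasiConsecutivePattern 5} (hp : p ∈ tableClass row) (n : ℕ) :
    (p.1.avoiders n).ncard = wordCount (row.headD []) n := by
  rcases hp with hp | hp
  · rw [VincularPattern.ncard_avoiders_eq_wordCount p.2, wordCount_eq_headD n row h _ hp]
  · rw [← VincularPattern.ncard_avoiders_complement,
      VincularPattern.ncard_avoiders_eq_wordCount (p := p.1.complement) p.2,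
      wordCount_eq_headD n row h _ hp]

theorem exists_mem_tableClass (p : QuasiConsecutivePattern 5) :
    ∃ row ∈ classTable, p ∈ tableClass row := by
  obtain ⟨row, hrow, h⟩ := exists_mem_classTable p.1.perm
  refine ⟨row, hrow, ?_⟩
  rwa [tableClass, Set.mem_ofPred_eq, VincularPattern.word_complement]

theorem tableClass_nonempty {row : List (List ℕ)} (h : row ∈ classTable) :
    (tableClass row).Nonempty := by
  obtain ⟨σ, hσ⟩ := exists_word_mem_row row h
  exact ⟨QuasiConsecutivePattern.ofPerm σ, Or.inl hσ⟩

/-- Every pattern lies in some row. Equality of the counts at length ten forces the two rows to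
coincide, while within a row the counts agree at every length. -/
theorem wilfEquiv_iff_mem_tableClass {row : List (List ℕ)} (h : row ∈ classTable)
    {p : QuasiConsecutivePattern 5} (hp : p ∈ tableClass row) (q : QuasiConsecutivePattern 5) :
    wilfSetoid 5 q p ↔ q ∈ tableClass row := by
  constructor
  · intro hqp
    obtain ⟨row', h', hq⟩ := exists_mem_tableClass q
    have := hqp 10 (by norm_num)
    rw [ncard_avoiders_of_mem_tableClass h hp, ncard_avoiders_of_mem_tableClass h' hq] at this
    rwa [classTable_eq_of_wordCount_eq h h' this.symm]
  · intro hq n _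
    rw [ncard_avoiders_of_mem_tableClass h hp, ncard_avoiders_of_mem_tableClass h hq]

theorem classes_wilfSetoid_five :
    (wilfSetoid 5).classes = {C | ∃ row ∈ classTable, C = tableClass row} := by
  ext C
  constructor
  · rintro ⟨p, rfl⟩
    obtain ⟨row, h, hp⟩ := exists_mem_tableClass p
    exact ⟨row, h, Set.ext fun q => wilfEquiv_iff_mem_tableClass h hp q⟩
  · rintro ⟨row, h, rfl⟩
    obtain ⟨p, hp⟩ := tableClass_nonempty h
    exact ⟨p, Set.ext fun q => (wilfEquiv_iff_mem_tableClass h hp q).symm⟩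

theorem tableClass_injOn : Set.InjOn tableClass {row | row ∈ classTable} := by
  intro row h row' h' he
  obtain ⟨p, hp⟩ := tableClass_nonempty h
  refine classTable_eq_of_wordCount_eq h h' ?_
  rw [← ncard_avoiders_of_mem_tableClass h hp, ← ncard_avoiders_of_mem_tableClass h' (he ▸ hp)]

/-- The Wilf-equivalence classes of the quasi-consecutive patterns `abcd-e` of length 5 are exactly
the 26 rows of the table, and these are 26 different classes. -/
theorem mainTheorem1 :
    (wilfSetoid 5).classes = {C | ∃ row ∈ classTable, C = tableClass row} ∧
      (wilfSetoid 5).classes.ncard = 26 := by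
  refine ⟨classes_wilfSetoid_five, ?_⟩
  have himage : {C | ∃ row ∈ classTable, C = tableClass row} =
      tableClass '' {row | row ∈ classTable} := by
    ext C
    simp only [Set.mem_ofPred_eq, Set.mem_image, eq_comm]
  have hset : {row | row ∈ classTable} = (classTable.toFinset : Set (List (List ℕ))) := by
    ext row
    simp
  rw [classes_wilfSetoid_five, himage, tableClass_injOn.ncard_image, hset,
    Set.ncard_coe_finset]
  decide +kernel
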